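/- Let $d\ge 1$, let $E$ be either $C_b(\mathbb R^d)$ (bounded continuous real functions) or $BUC(\mathbb R^d)$ (bounded uniformly continuous real functions), both with the sup-norm, and for $r>0$ put $E_r^+=\{v\in E: 0\le v\le r\}$. Let $\varkappa,m>0$, let $0\le a\in L^1(\mathbb R^d)$ with $\int a=1$, let $G:E\to E$, and consider $$\partial_t u=\varkappa\,(a*u)-m\,u-u\,Gu,\qquad t>0,\ x\in\mathbb R^d, \tag{1}$$ where $(a*u)(x,t)=\int a(x-y)u(y,t)\,dy$. With $(T_yv)(x)=v(x-y)$, assume: (A1) $\beta:=\varkappa-m>0$; (A2) there is $\theta>0$ with $0=G0\le Gv\le G\theta=\beta$ for all $v\in E_\theta^+$; (A3) there is $l>0$ with $\|Gv-Gw\|\le l\|v-w\|$ for all $v,w\in E_\theta^+$; (A4) there is $p\ge0$ such that $\varkappa a*v-v\,Gv+pv\le\varkappa a*w-w\,Gw+pw$ for all $v,w\in E_\theta^+$ with $v\le w$; (A5) there is $\varrho>0$ with $a(x)\ge\varrho$ for a.a. $|x|<\varrho$; (A6) if $v_n,v\in E_\theta^+$ and $v_n\to v$ uniformly on compact sets,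 then $Gv_n\to Gv$ uniformly on compact sets; (A7) $T_yGv=GT_yv$ for all $v\in E_\theta^+$, $y\in\mathbb R^d$; (A8) $Gr<\beta$ for every constant $r\in(0,\theta)$. The solution of (1) with initial condition $f\in E_\theta^+$ means the function $u\in C([0,\infty)\to E)\cap C^1((0,\infty)\to E)$ with $0\le u\le\theta$, $u(\cdot,0)=f$, that satisfies (1) for $t>0$ (it exists and is unique); put $Q_tf:=u(\cdot,t)$. Fix a continuous non-increasing $\varphi:\mathbb R\to\mathbb R$ with $\varphi=0$ on $[0,\infty)$ and $\lim_{s\to-\infty}\varphi(s)\in(0,\theta)$. For $t>0$, $c\in\mathbb R$ and a unit vector $\xi\in\mathbb R^d$ let $f_0=\varphi$ and $$f_{n+1}(s)=\max\bigl\{\varphi(s),\ \bigl(Q_t[x\mapsto f_n(x\cdot\xi+s+c)]\bigr)(0)\bigr\},\qquad f_{t,c,\xi}(s)=\lim_{n\to\infty}f_n(s),$$ and let $$c_t^*(\xi)=\sup\bigl\{c\in\mathbb R:\lim_{s\to\infty}f_{t,c,\xi}(s)=\theta\bigr\}\in[-\infty,\infty],\qquad \Upsilon_t=\{x\in\mathbb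 R^d: x\cdot\xi\le c_t^*(\xi)\text{ for all }|\xi|=1\}.$$ Let $\mathcal C\subset\operatorname{int}(\Upsilon_1)$ be compact and suppose that there is $\nu\in\operatorname{int}(\mathcal C)$ such that $\frac1j\nu\in\operatorname{int}(\Upsilon_{1/j})$ for all $j\in\mathbb N=\{1,2,\dots\}$. Let $\sigma\in(0,\theta)$. Call $r>0$ an admissible radius if, for all $v_0\in E_\theta^+$ and $x_0\in\mathbb R^d$, $$v_0\ge\sigma\ \text{on}\ B_r(x_0)\quad\text{implies}\quad \lim_{n\to\infty}\min_{x\in n\mathcal C}(Q_1^nv_0)(x)=\theta .$$ Then an admissible radius exists. Moreover, for every admissible radius $r_\sigma$ and every $u_0\in BUC(\mathbb R^d)$ with $0\le u_0\le\theta$ on $\mathbb R^d$ and $u_0\ge\sigma$ on $B_{r_\sigma}(0)$, there is a unique solution $u$ of (1) with $u(\cdot,0)=u_0$, and for every non-empty compact $K\subset\mathbb R^d$ $$\min_{x\in K}u(x+t\nu,t)\to\theta\qquad\text{as }t\to\infty .$$ -/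

import Mathlib

open Set Filter Topology MeasureTheory
open scoped BoundedContinuousFunction Pointwise

noncomputable section

namespace HairTrigger

/-- The Euclidean space of dimension `d`. -/
abbrev Space (d : ℕ) : Type := EuclideanSpace ℝ (Fin d)

/-- The Banach space of bounded continuous real functions on `Space d`, with the sup norm. -/
abbrev Cb (d : ℕ) : Type := Space d →ᵇ ℝ

/-- The (closed) subspace of bounded uniformly continuous functions. -/
def Buc (d : ℕ) : Set (Cb d) := {v | UniformContinuous v}

/-- The order interval `{v ∈ E : 0 ≤ v ≤ r}`. -/
def tube {d : ℕ} (E : Set (Cb d)) (r : ℝ) : Set (Cb d) :=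
  {v | v ∈ E ∧ ∀ x, 0 ≤ v x ∧ v x ≤ r}

/-- The constant function `r`. -/
def constFun (d : ℕ) (r : ℝ) : Cb d := BoundedContinuousFunction.const (Space d) r

/-- The translation `(T_y v)(x) = v (x - y)`. -/
def translate {d : ℕ} (y : Space d) (v : Cb d) : Cb d :=
  v.compContinuous ⟨fun x => x - y, by fun_prop⟩

/-- Uniform convergence on all compact sets. -/
def LocUnifConv {d : ℕ} (v : ℕ → Cb d) (w : Cb d) : Prop :=
  ∀ K : Set (Space d), IsCompact K → TendstoUniformlyOn (fun n x => v n x) (fun x => w x) atTop K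

/-- The convolution `(a * v)(x) = ∫ a (x - y) v(y) dy`. -/
def conv {d : ℕ} (a : Space d → ℝ) (v : Cb d) (x : Space d) : ℝ :=
  ∫ y, a (x - y) * v y

/-- A nonnegative probability kernel. -/
structure IsProbabilityKernel {d : ℕ} (a : Space d → ℝ) : Prop where
  nonneg : ∀ᵐ x, 0 ≤ a x
  integrable : Integrable a
  integral_eq_one : ∫ x, a x = 1

/-- The assumptions on the coefficients of
`∂u/∂t = κ a * u - m u - u G u` in the space `E`. Here `G` acts in `E`, and only its values on
`{v ∈ E : 0 ≤ v ≤ θ}` matter; `β = κ - m`. -/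
structure Assumptions {d : ℕ} (E : Set (Cb d)) (a : Space d → ℝ) (κ m θ : ℝ)
    (G : Cb d → Cb d) : Prop where
  mapsTo : MapsTo G (tube E θ) E
  beta_pos : 0 < κ - m
  theta_pos : 0 < θ
  map_zero : G (constFun d 0) = constFun d 0
  map_theta : G (constFun d θ) = constFun d (κ - m)
  bounds : ∀ v ∈ tube E θ, ∀ x, 0 ≤ G v x ∧ G v x ≤ κ - m
  lipschitz : ∃ l : ℝ, 0 < l ∧ ∀ v ∈ tube E θ, ∀ w ∈ tube E θ, ‖G v - G w‖ ≤ l * ‖v - w‖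
  quasi_monotone : ∃ p : ℝ, 0 ≤ p ∧ ∀ v ∈ tube E θ, ∀ w ∈ tube E θ, (∀ x, v x ≤ w x) →
    ∀ x, κ * conv a v x - v x * G v x + p * v x ≤ κ * conv a w x - w x * G w x + p * w x
  kernel_nondegenerate : ∃ ρ : ℝ, 0 < ρ ∧ ∀ᵐ x, x ∈ Metric.ball (0 : Space d) ρ → ρ ≤ a x
  locally_continuous : ∀ (v : ℕ → Cb d) (w : Cb d), (∀ n, v n ∈ tube E θ) → w ∈ tube E θ →
    LocUnifConv v w → LocUnifConv (fun n => G (v n)) (G w)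
  translation_invariant : ∀ (y : Space d), ∀ v ∈ tube E θ, translate y (G v) = G (translate y v)
  const_lt : ∀ r : ℝ, 0 < r → r < θ → ∀ x, G (constFun d r) x < κ - m

/-- `u` is a classical solution on `[0, ∞)` of `∂u/∂t = κ a * u - m u - u G u` in `E`, with initial
condition `f` and with `0 ≤ u ≤ θ` (the region in which `G` is controlled):
`u ∈ C([0,∞) → E) ∩ C¹((0,∞) → E)`. The values of `u` at negative times are irrelevant. -/
structure IsSolution {d : ℕ} (E : Set (Cb d)) (a : Space d → ℝ) (κ m θ : ℝ)
    (G : Cb d → Cb d) (f : Space d → ℝ) (u : ℝ → Cb d) : Prop where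
  mem_tube : ∀ t, 0 ≤ t → u t ∈ tube E θ
  initial : ∀ x, u 0 x = f x
  continuousOn : ContinuousOn u (Ici 0)
  equation : ∃ u' : ℝ → Cb d, ContinuousOn u' (Ioi 0) ∧ (∀ t, 0 < t → HasDerivAt u (u' t) t) ∧
    ∀ t, 0 < t → ∀ x, u' t x = κ * conv a (u t) x - m * u t x - u t x * G (u t) x

open Classical in
/-- The time-`t` map `f ↦ u(·, t)`, where `u` is the solution with the initial condition `f`.
(It is used only for `f ∈ E` with `0 ≤ f ≤ θ`, where the solution exists and is unique.) -/
def Q {d : ℕ} (E : Set (Cb d)) (a : Space d → ℝ) (κ m θ : ℝ) (G : Cb d → Cb d)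
    (t : ℝ) (f : Space d → ℝ) : Space d → ℝ :=
  if h : ∃ u : ℝ → Cb d, IsSolution E a κ m θ G f u then fun x => Classical.choose h t x
  else fun _ => 0

/-- The set `N_θ` of continuous non-increasing functions on `ℝ` that vanish on `[0, ∞)` and have
a limit in `(0, θ)` at `-∞`. -/
def profiles (θ : ℝ) : Set (ℝ → ℝ) :=
  {φ | Continuous φ ∧ Antitone φ ∧ (∀ s, 0 ≤ s → φ s = 0) ∧
    ∃ l : ℝ, 0 < l ∧ l < θ ∧ Tendsto φ atBot (𝓝 l)}

/-- `(V_{s,c,ξ} g)(x) = g (x · ξ + s + c)`. -/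
def V {d : ℕ} (s c : ℝ) (ξ : Space d) (g : ℝ → ℝ) (x : Space d) : ℝ :=
  g (inner ℝ x ξ + s + c)

/-- `(R_{t,c,ξ} g)(s) = max {φ(s), (Q_t (V_{s,c,ξ} g))(0)}`. -/
def R {d : ℕ} (E : Set (Cb d)) (a : Space d → ℝ) (κ m θ : ℝ) (G : Cb d → Cb d) (φ : ℝ → ℝ)
    (t c : ℝ) (ξ : Space d) (g : ℝ → ℝ) (s : ℝ) : ℝ :=
  max (φ s) (Q E a κ m θ G t (V s c ξ g) 0)

/-- `f_{t,c,ξ}(∞) = θ`, where `f_{t,c,ξ}(s) = lim_n (R_{t,c,ξ}^n φ)(s)`. -/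
def LimitIsTheta {d : ℕ} (E : Set (Cb d)) (a : Space d → ℝ) (κ m θ : ℝ) (G : Cb d → Cb d)
    (φ : ℝ → ℝ) (t c : ℝ) (ξ : Space d) : Prop :=
  ∃ f : ℝ → ℝ, (∀ s, Tendsto (fun n : ℕ => (R E a κ m θ G φ t c ξ)^[n] φ s) atTop (𝓝 (f s))) ∧
    Tendsto f atTop (𝓝 θ)

/-- `c_t^*(ξ) = sup {c : f_{t,c,ξ}(∞) = θ}`, an extended real number (`sup ∅ = -∞`). -/
def cStar {d : ℕ} (E : Set (Cb d)) (a : Space d → ℝ) (κ m θ : ℝ) (G : Cb d → Cb d)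
    (φ : ℝ → ℝ) (t : ℝ) (ξ : Space d) : EReal :=
  sSup ((fun c : ℝ => (c : EReal)) '' {c : ℝ | LimitIsTheta E a κ m θ G φ t c ξ})

/-- `Υ_t = {x : x · ξ ≤ c_t^*(ξ) for all unit vectors ξ}`. -/
def Upsilon {d : ℕ} (E : Set (Cb d)) (a : Space d → ℝ) (κ m θ : ℝ) (G : Cb d → Cb d)
    (φ : ℝ → ℝ) (t : ℝ) : Set (Space d) :=
  {x | ∀ ξ : Space d, ‖ξ‖ = 1 → ((inner ℝ x ξ : ℝ) : EReal) ≤ cStar E a κ m θ G φ t ξ}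

/-- `r` is an admissible radius `r_σ(Q_t, C)`: if `v₀ ∈ E`, `0 ≤ v₀ ≤ θ`, and `v₀ ≥ σ` on some ball
of radius `r`, then the minimum of `Q_t^n v₀` over `n C` tends to `θ`. -/
def IsWeinbergerRadius {d : ℕ} (E : Set (Cb d)) (a : Space d → ℝ) (κ m θ : ℝ) (G : Cb d → Cb d)
    (t : ℝ) (C : Set (Space d)) (σ r : ℝ) : Prop :=
  0 < r ∧ ∀ v₀ ∈ tube E θ, ∀ x₀ : Space d, (∀ x ∈ Metric.ball x₀ r, σ ≤ v₀ x) →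
    Tendsto (fun n : ℕ => sInf ((Q E a κ m θ G t)^[n] v₀ '' ((n : ℝ) • C))) atTop (𝓝 θ)

end HairTrigger

end

open HairTrigger

/-!
The equation is written as `u' = -q u + H u` with `q = m + p`, where `H` is order preserving on
`{v ∈ E : 0 ≤ v ≤ θ}`, maps `0` to `0` and `θ` to `q θ`. Picard iteration for the integrated
equation converges for all times in a weighted norm, and the iterates stay between `0` and `θ`,
are monotone in the initial condition, commute with translations and depend continuously on the
initial condition for locally uniform convergence; so the flow has these properties
(`IsMonotoneReaction.flow_isMonotoneEvolution`). Positive constants are driven to `θ`, because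
`G r < β` for `0 < r < θ` (`IsMonotoneReaction.tendsto_flow_const`).

An admissible radius exists by the following argument for the time-one map `P`. Every point `p` of
`C` has a ball around it in `Υ`. In the frame moving with `p`, the spreading speeds in all
directions exceed some `c > 0`, so Weinberger's planar iterates with speed `c` converge to `θ` in
every direction. Consider the same iteration started from a large sphere (`radial`), which expands
with speed `c` and is slightly cut off. Near the sphere and for finitely many steps it is close to
the planar iteration (`radial_locConv`). Hence, by compactness of the set of directions, for some
number `N` of steps and all large radii the maximum with the profile in the definition of the next
iterate is redundant (`exists_lt_radial`, `radial_le_map`): the `N`-th iterate from radius `L` is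
mapped by `P` above the `N`-th iterate from radius `L + c`. This subsolution has bounded support
and a supremum below `θ`, so a state that is at least `σ` on a large ball exceeds it after some
steps, since the constant `σ` is driven to `θ`. The state is then bounded below by a positive
constant on balls expanding with speed `c`, and this constant is driven to `θ` as well
(`exists_spreading_radius`). Finitely many of these balls cover `C`.

For the solution in continuous time, write `t = n + s` with `n` an integer and `s ∈ [1, 2]`. At time
`n` the solution is close to `θ` on `n C`, which contains a ball around `x + t ν` whose radius tends
to infinity. The value at time `t` depends, up to a small error that is uniform in `s ∈ [1, 2]`, only
on the values on a ball of fixed radius at time `n` (`exists_radius_flow`, `tendsto_flow_along_ray`).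
-/

noncomputable section

namespace HairTrigger

variable {d : ℕ} {E : Set (Cb d)}

/-! ### The phase space and locally uniform convergence -/

@[simp] lemma translate_apply (y : Space d) (v : Cb d) (x : Space d) :
    translate y v x = v (x - y) := rfl

@[simp] lemma constFun_apply (r : ℝ) (x : Space d) : constFun d r x = r := rfl

lemma uniformContinuous_iff_dist {X : Type*} [UniformSpace X] {f : X → ℝ} :
    UniformContinuous f ↔ Tendsto (fun p : X × X => dist (f p.1) (f p.2)) (uniformity X) (𝓝 0) :=
  tendsto_uniformity_iff_dist_tendsto_zero

lemma mem_of_uniformContinuous (hE : E = univ ∨ E = Buc d) {v : Cb d}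
    (hv : UniformContinuous v) : v ∈ E := by
  rcases hE with rfl | rfl
  · trivial
  · exact hv

lemma const_mem (hE : E = univ ∨ E = Buc d) (r : ℝ) : constFun d r ∈ E :=
  mem_of_uniformContinuous hE uniformContinuous_const

lemma translate_mem (hE : E = univ ∨ E = Buc d) {v : Cb d} (hv : v ∈ E) (y : Space d) :
    translate y v ∈ E := by
  rcases hE with rfl | rfl
  · trivial
  · exact UniformContinuous.comp hv (uniformContinuous_id.sub uniformContinuous_const)

lemma sup_mem (hE : E = univ ∨ E = Buc d) {v w : Cb d} (hv : v ∈ E) (hw : w ∈ E) :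
    v ⊔ w ∈ E := by
  rcases hE with rfl | rfl
  · trivial
  · refine uniformContinuous_iff_dist.2 ?_
    have h := (uniformContinuous_iff_dist.1 hv).add (uniformContinuous_iff_dist.1 hw)
    rw [add_zero] at h
    refine squeeze_zero (fun _ => dist_nonneg) (fun p => ?_) h
    simp only [Real.dist_eq]
    exact (abs_max_sub_max_le_max _ _ _ _).trans (max_le_add_of_nonneg (abs_nonneg _) (abs_nonneg _))

lemma add_mem' (hE : E = univ ∨ E = Buc d) {v w : Cb d} (hv : v ∈ E) (hw : w ∈ E) :
    v + w ∈ E := by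
  rcases hE with rfl | rfl
  · trivial
  · exact UniformContinuous.add hv hw

lemma sub_mem' (hE : E = univ ∨ E = Buc d) {v w : Cb d} (hv : v ∈ E) (hw : w ∈ E) :
    v - w ∈ E := by
  rcases hE with rfl | rfl
  · trivial
  · exact UniformContinuous.sub hv hw

lemma mul_mem' (hE : E = univ ∨ E = Buc d) {v w : Cb d} (hv : v ∈ E) (hw : w ∈ E) :
    v * w ∈ E := by
  rcases hE with rfl | rfl
  · trivial
  · refine uniformContinuous_iff_dist.2 ?_
    have h := ((uniformContinuous_iff_dist.1 hv).mul_const ‖w‖).add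
      ((uniformContinuous_iff_dist.1 hw).const_mul ‖v‖)
    simp only [zero_mul, mul_zero, add_zero] at h
    refine squeeze_zero (fun _ => dist_nonneg) (fun p => ?_) h
    simp only [Real.dist_eq, BoundedContinuousFunction.coe_mul, Pi.mul_apply]
    calc |v p.1 * w p.1 - v p.2 * w p.2|
        = |(v p.1 - v p.2) * w p.1 + v p.2 * (w p.1 - w p.2)| := by ring_nf
      _ ≤ |(v p.1 - v p.2) * w p.1| + |v p.2 * (w p.1 - w p.2)| := abs_add_le _ _
      _ ≤ _ := by
        rw [abs_mul, abs_mul]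
        gcongr
        · exact w.norm_coe_le_norm _
        · exact v.norm_coe_le_norm _

lemma smul_mem' (hE : E = univ ∨ E = Buc d) {v : Cb d} (hv : v ∈ E) (r : ℝ) :
    r • v ∈ E := by
  have h := mul_mem' hE (const_mem hE r) hv
  convert h using 1
  ext x
  simp

lemma isClosed_phase (hE : E = univ ∨ E = Buc d) : IsClosed E := by
  rcases hE with rfl | rfl
  · exact isClosed_univ
  · refine IsSeqClosed.isClosed fun v w hv hw => ?_
    exact (BoundedContinuousFunction.tendsto_iff_tendstoUniformly.1 hw).uniformContinuous
      (Frequently.of_forall hv)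

lemma isClosed_tube (hE : E = univ ∨ E = Buc d) (θ : ℝ) : IsClosed (tube E θ) := by
  have : tube E θ = E ∩ ⋂ x, {v : Cb d | 0 ≤ v x ∧ v x ≤ θ} := by
    ext v; simp [tube]
  rw [this]
  refine (isClosed_phase hE).inter (isClosed_iInter fun x => ?_)
  have hx : Continuous fun v : Cb d => v x := 
    (BoundedContinuousFunction.evalCLM ℝ x).continuous
  exact (isClosed_le continuous_const hx).inter (isClosed_le hx continuous_const)

lemma norm_le_of_mem_tube {θ : ℝ} (hθ : 0 ≤ θ) {v : Cb d} (hv : v ∈ tube E θ) : ‖v‖ ≤ θ := by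
  rw [BoundedContinuousFunction.norm_le hθ]
  intro x
  rw [Real.norm_eq_abs, abs_of_nonneg (hv.2 x).1]
  exact (hv.2 x).2

lemma norm_sub_le_of_mem_tube {θ : ℝ} (hθ : 0 ≤ θ) {v w : Cb d} (hv : v ∈ tube E θ)
    (hw : w ∈ tube E θ) : ‖v - w‖ ≤ θ := by
  rw [BoundedContinuousFunction.norm_le hθ]
  intro x
  rw [Real.norm_eq_abs, BoundedContinuousFunction.coe_sub, Pi.sub_apply, abs_le]
  constructor <;> linarith [(hv.2 x).1, (hv.2 x).2, (hw.2 x).1, (hw.2 x).2]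

lemma const_mem_tube (hE : E = univ ∨ E = Buc d) {r θ : ℝ} (h0 : 0 ≤ r) (h1 : r ≤ θ) :
    constFun d r ∈ tube E θ :=
  ⟨const_mem hE r, fun _ => ⟨h0, h1⟩⟩

lemma translate_mem_tube (hE : E = univ ∨ E = Buc d) {θ : ℝ} {v : Cb d} (hv : v ∈ tube E θ)
    (y : Space d) : translate y v ∈ tube E θ :=
  ⟨translate_mem hE hv.1 y, fun _ => hv.2 _⟩

/-- Continuous convergence `v_n(x_n) → w(x)` whenever `n → ∞` and `x_n → x`, in filter form. For
continuous limits it is the same as locally uniform convergence, and it is the form that is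
compatible with dominated convergence. -/
def LocConv (v : ℕ → Cb d) (w : Cb d) : Prop :=
  ∀ x, Tendsto (fun q : ℕ × Space d => v q.1 q.2) (atTop ×ˢ 𝓝 x) (𝓝 (w x))

lemma locConv_iff_tendstoLocallyUniformly {v : ℕ → Cb d} {w : Cb d} :
    LocConv v w ↔ TendstoLocallyUniformly (fun n x => v n x) w atTop := by
  rw [tendstoLocallyUniformly_iff_filter]
  refine forall_congr' fun x => ?_
  rw [tendstoUniformlyOnFilter_iff_tendsto, tendsto_uniformity_iff_dist_tendsto_zero,
    tendsto_iff_dist_tendsto_zero (a := w x)]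
  have hw : Tendsto (fun q : ℕ × Space d => dist (w q.2) (w x)) (atTop ×ˢ 𝓝 x) (𝓝 0) :=
    tendsto_iff_dist_tendsto_zero.1 ((w.continuous.tendsto x).comp tendsto_snd)
  constructor <;> intro h
  · refine squeeze_zero (fun _ => dist_nonneg) (fun q => ?_) (by simpa using hw.add h)
    rw [dist_comm (v q.1 q.2)]
    exact dist_triangle _ _ _
  · refine squeeze_zero (fun _ => dist_nonneg) (fun q => ?_) (by simpa using hw.add h)
    rw [add_comm]
    exact dist_triangle_left _ _ (w q.2)

lemma locConv_iff_locUnifConv {v : ℕ → Cb d} {w : Cb d} : LocConv v w ↔ LocUnifConv v w := by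
  rw [locConv_iff_tendstoLocallyUniformly, tendstoLocallyUniformly_iff_forall_isCompact]
  rfl

lemma LocConv.tendsto_apply {v : ℕ → Cb d} {w : Cb d} (h : LocConv v w) (x : Space d) :
    Tendsto (fun n => v n x) atTop (𝓝 (w x)) :=
  (h x).comp (tendsto_id.prodMk (tendsto_const_nhds (x := x)))

/-! ### The convolution -/

lemma conv_eq (a : Space d → ℝ) (v : Cb d) (x : Space d) :
    conv a v x = ∫ z, a z * v (x - z) := by
  have := integral_sub_left_eq_self (fun z => a z * v (x - z)) volume x
  simpa [conv] using this


lemma IsProbabilityKernel.integral_norm {a : Space d → ℝ} (ha : IsProbabilityKernel a) :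
    ∫ z, ‖a z‖ = 1 := by
  rw [← ha.integral_eq_one]
  refine integral_congr_ae ?_
  filter_upwards [ha.nonneg] with z hz
  rw [Real.norm_eq_abs, abs_of_nonneg hz]

lemma IsProbabilityKernel.integrable_mul {a : Space d → ℝ} (ha : IsProbabilityKernel a)
    (v : Cb d) (x : Space d) : Integrable fun z => a z * v (x - z) := by
  refine (ha.integrable.norm.mul_const ‖v‖).mono' ?_ (Eventually.of_forall fun z => ?_)
  · exact ha.integrable.aestronglyMeasurable.mul
      (v.continuous.comp (continuous_const.sub continuous_id)).aestronglyMeasurable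
  · rw [norm_mul]
    gcongr
    exact v.norm_coe_le_norm _

/-- Dominated convergence for the convolution, along a countably generated filter. -/
lemma IsProbabilityKernel.tendsto_conv {a : Space d → ℝ} (ha : IsProbabilityKernel a)
    {ι : Type*} {F : Filter ι} [F.IsCountablyGenerated] {v : ι → Cb d} {x : ι → Space d}
    {w : Cb d} {x₀ : Space d} {M : ℝ} (hM : ∀ i, ‖v i‖ ≤ M)
    (h : ∀ z, Tendsto (fun i => v i (x i - z)) F (𝓝 (w (x₀ - z)))) :
    Tendsto (fun i => conv a (v i) (x i)) F (𝓝 (conv a w x₀)) := by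
  simp only [conv_eq]
  refine tendsto_integral_filter_of_dominated_convergence (fun z => ‖a z‖ * M)
    (Eventually.of_forall fun i => (ha.integrable_mul _ _).aestronglyMeasurable)
    (Eventually.of_forall fun i => Eventually.of_forall fun z => ?_)
    (ha.integrable.norm.mul_const M)
    (Eventually.of_forall fun z => (h z).const_mul _)
  rw [norm_mul]
  gcongr
  exact ((v i).norm_coe_le_norm _).trans (hM i)

lemma IsProbabilityKernel.abs_conv_le {a : Space d → ℝ} (ha : IsProbabilityKernel a)
    (v : Cb d) (x : Space d) : ‖conv a v x‖ ≤ ‖v‖ := by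
  rw [conv_eq]
  calc ‖∫ z, a z * v (x - z)‖ ≤ ∫ z, ‖a z‖ * ‖v‖ := by
        refine norm_integral_le_of_norm_le (ha.integrable.norm.mul_const _)
          (Eventually.of_forall fun z => ?_)
        rw [norm_mul]
        gcongr
        exact v.norm_coe_le_norm _
    _ = ‖v‖ := by rw [integral_mul_const, ha.integral_norm, one_mul]

/-- The convolution with a probability kernel as a bounded continuous function. -/
def convB (a : Space d → ℝ) (ha : IsProbabilityKernel a) (v : Cb d) : Cb d :=
  BoundedContinuousFunction.ofNormedAddCommGroup (conv a v)
    (continuous_iff_continuousAt.2 fun x => ha.tendsto_conv (v := fun _ => v) (x := id)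
      (fun _ => le_rfl) fun _ =>
        (v.continuous.comp (continuous_id.sub continuous_const)).tendsto x)
    ‖v‖ (ha.abs_conv_le v)

@[simp] lemma convB_apply (a : Space d → ℝ) (ha : IsProbabilityKernel a) (v : Cb d)
    (x : Space d) : convB a ha v x = conv a v x := rfl

lemma convB_sub (a : Space d → ℝ) (ha : IsProbabilityKernel a) (v w : Cb d) :
    convB a ha (v - w) = convB a ha v - convB a ha w := by
  ext x
  simp only [convB_apply, BoundedContinuousFunction.coe_sub, Pi.sub_apply, conv_eq]
  rw [← integral_sub (ha.integrable_mul v x) (ha.integrable_mul w x)]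
  simp only [mul_sub]

lemma norm_convB_le (a : Space d → ℝ) (ha : IsProbabilityKernel a) (v : Cb d) :
    ‖convB a ha v‖ ≤ ‖v‖ :=
  (BoundedContinuousFunction.norm_le (norm_nonneg _)).2 (ha.abs_conv_le v)

lemma convB_const (a : Space d → ℝ) (ha : IsProbabilityKernel a) (r : ℝ) :
    convB a ha (constFun d r) = constFun d r := by
  ext x
  simp [conv_eq, integral_mul_const, ha.integral_eq_one]

lemma convB_translate (a : Space d → ℝ) (ha : IsProbabilityKernel a) (y : Space d) (v : Cb d) :
    convB a ha (translate y v) = translate y (convB a ha v) := by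
  ext x
  simp only [convB_apply, translate_apply, conv_eq]
  simp only [sub_right_comm]

lemma convB_mem (hE : E = univ ∨ E = Buc d) (a : Space d → ℝ) (ha : IsProbabilityKernel a)
    {v : Cb d} (hv : v ∈ E) : convB a ha v ∈ E := by
  rcases hE with rfl | rfl
  · trivial
  · rw [Buc, mem_ofPred_eq, Metric.uniformContinuous_iff] at hv ⊢
    intro ε hε
    obtain ⟨δ, hδ, h⟩ := hv (ε / 2) (half_pos hε)
    refine ⟨δ, hδ, fun {x y} hxy => ?_⟩
    -- the oscillation of the convolution is the convolution of a difference of translates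
    have key : ‖v - translate (x - y) v‖ ≤ ε / 2 := by
      rw [BoundedContinuousFunction.norm_le (half_pos hε).le]
      intro z
      have := h (a := z) (b := z - (x - y)) (by simpa [dist_eq_norm] using hxy)
      simpa [dist_eq_norm] using this.le
    have h2 := ((convB a ha (v - translate (x - y) v)).norm_coe_le_norm x).trans
      ((norm_convB_le a ha _).trans key)
    rw [convB_sub, convB_translate] at h2
    simp only [BoundedContinuousFunction.coe_sub, Pi.sub_apply, translate_apply, sub_sub_cancel]
      at h2
    rw [dist_eq_norm]
    linarith

lemma LocConv.convB {a : Space d → ℝ} (ha : IsProbabilityKernel a) {v : ℕ → Cb d} {w : Cb d}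
    {M : ℝ} (hM : ∀ n, ‖v n‖ ≤ M) (h : LocConv v w) :
    LocConv (fun n => HairTrigger.convB a ha (v n)) (HairTrigger.convB a ha w) := fun x =>
  ha.tendsto_conv (v := fun q : ℕ × Space d => v q.1) (x := Prod.snd) (fun q => hM q.1) fun z =>
    (h (x - z)).comp (tendsto_fst.prodMk (tendsto_snd.sub_const z))

/-! ### The flow of a monotone Lipschitz equation -/

lemma intervalIntegral_apply {g : ℝ → Cb d} (hg : Continuous g) (a b : ℝ) (x : Space d) :
    (∫ s in a..b, g s) x = ∫ s in a..b, g s x :=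
  ((BoundedContinuousFunction.evalCLM ℝ x).intervalIntegral_comp_comm
    (hg.intervalIntegrable a b)).symm

lemma continuous_apply_path {g : ℝ → Cb d} (hg : Continuous g) (x : Space d) :
    Continuous fun s => g s x :=
  (BoundedContinuousFunction.evalCLM ℝ x).continuous.comp hg

lemma intervalIntegral_mem (hE : E = univ ∨ E = Buc d) {g : ℝ → Cb d} (hg : Continuous g)
    (hgE : ∀ s, g s ∈ E) (a b : ℝ) : ∫ s in a..b, g s ∈ E := by
  rcases hE with rfl | rfl
  · trivial
  · refine uniformContinuous_iff_dist.2 ?_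
    have key : Tendsto (fun p : Space d × Space d => ∫ s in a..b, (g s p.1 - g s p.2))
        (uniformity _) (𝓝 (∫ s in a..b, (0 : ℝ))) := by
      refine intervalIntegral.tendsto_integral_filter_of_dominated_convergence
        (fun s => 2 * ‖g s‖) (Eventually.of_forall fun p => ?_)
        (Eventually.of_forall fun p => Eventually.of_forall fun s _ => ?_)
        ((continuous_const.mul hg.norm).intervalIntegrable a b)
        (Eventually.of_forall fun s _ => ?_)
      · exact ((continuous_apply_path hg _).sub
          (continuous_apply_path hg _)).aestronglyMeasurable
      · exact (norm_sub_le _ _).trans (by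
          linarith [(g s).norm_coe_le_norm p.1, (g s).norm_coe_le_norm p.2])
      · exact tendsto_zero_iff_norm_tendsto_zero.2 (uniformContinuous_iff_dist.1 (hgE s))
    rw [intervalIntegral.integral_zero] at key
    refine (tendsto_zero_iff_norm_tendsto_zero.1 key).congr fun p => ?_
    rw [intervalIntegral.integral_sub
      ((continuous_apply_path hg _).intervalIntegrable _ _)
      ((continuous_apply_path hg _).intervalIntegrable _ _),
      ← intervalIntegral_apply hg, ← intervalIntegral_apply hg, Real.dist_eq, Real.norm_eq_abs]

/-- A nonlinearity `H` for which the equation `u' = -q u + H u` is order preserving on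
`{v ∈ E : 0 ≤ v ≤ θ}` and has the stationary solutions `0` and `θ`. -/
structure IsMonotoneReaction (E : Set (Cb d)) (θ q : ℝ) (H : Cb d → Cb d) : Prop where
  phase : E = univ ∨ E = Buc d
  q_pos : 0 < q
  top_pos : 0 < θ
  mem : ∀ v ∈ tube E θ, H v ∈ E
  lip : ∃ K : ℝ, 0 < K ∧ ∀ v ∈ tube E θ, ∀ w ∈ tube E θ, ‖H v - H w‖ ≤ K * ‖v - w‖
  mono : ∀ v ∈ tube E θ, ∀ w ∈ tube E θ, (∀ x, v x ≤ w x) → ∀ x, H v x ≤ H w x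
  map_zero : H (constFun d 0) = constFun d 0
  map_top : H (constFun d θ) = constFun d (q * θ)
  transl : ∀ y, ∀ v ∈ tube E θ, H (translate y v) = translate y (H v)
  cont : ∀ (v : ℕ → Cb d) (w : Cb d), (∀ n, v n ∈ tube E θ) → w ∈ tube E θ → LocConv v w →
    LocConv (fun n => H (v n)) (H w)

/-- The right-hand side `e^{-qt} (f + ∫₀ᵗ e^{qs} H(u(s)) ds)` of the integrated equation
`u' = -q u + H u`, `u(0) = f`; it is extended to negative times by its value at `0`. -/
def duhamel (q : ℝ) (H : Cb d → Cb d) (f : Cb d) (u : ℝ → Cb d) (t : ℝ) : Cb d :=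
  Real.exp (-(q * max t 0)) • (f + ∫ s in (0 : ℝ)..max t 0, Real.exp (q * s) • H (u s))

/-- Continuous paths in `{v ∈ E : 0 ≤ v ≤ θ}`. -/
def IsPath (E : Set (Cb d)) (θ : ℝ) (u : ℝ → Cb d) : Prop :=
  Continuous u ∧ ∀ t, u t ∈ tube E θ

section Duhamel

variable {θ q : ℝ} {H : Cb d → Cb d}

lemma IsMonotoneReaction.bounds (h : IsMonotoneReaction E θ q H) {v : Cb d}
    (hv : v ∈ tube E θ) (x : Space d) : 0 ≤ H v x ∧ H v x ≤ q * θ := by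
  constructor
  · have := h.mono _ (const_mem_tube h.phase le_rfl h.top_pos.le) v hv (fun x => (hv.2 x).1) x
    rwa [h.map_zero] at this
  · have := h.mono v hv _ (const_mem_tube h.phase h.top_pos.le le_rfl) (fun x => (hv.2 x).2) x
    rwa [h.map_top] at this

lemma IsMonotoneReaction.continuousOn (h : IsMonotoneReaction E θ q H) :
    ContinuousOn H (tube E θ) := by
  obtain ⟨K, hK, hl⟩ := h.lip
  have : LipschitzOnWith K.toNNReal H (tube E θ) :=
    LipschitzOnWith.of_dist_le_mul fun v hv w hw => by
      rw [dist_eq_norm, dist_eq_norm, Real.coe_toNNReal _ hK.le]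
      exact hl v hv w hw
  exact this.continuousOn

lemma IsMonotoneReaction.continuous_comp (h : IsMonotoneReaction E θ q H) {u : ℝ → Cb d}
    (hu : IsPath E θ u) : Continuous fun s => H (u s) :=
  h.continuousOn.comp_continuous hu.1 hu.2

lemma IsMonotoneReaction.continuous_integrand (h : IsMonotoneReaction E θ q H) {u : ℝ → Cb d}
    (hu : IsPath E θ u) : Continuous fun s => Real.exp (q * s) • H (u s) :=
  (by fun_prop : Continuous fun s : ℝ => Real.exp (q * s)).smul (h.continuous_comp hu)

lemma IsMonotoneReaction.duhamel_apply (h : IsMonotoneReaction E θ q H) {u : ℝ → Cb d}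
    (hu : IsPath E θ u) (f : Cb d) (t : ℝ) (x : Space d) :
    duhamel q H f u t x = Real.exp (-(q * max t 0)) *
      (f x + ∫ s in (0 : ℝ)..max t 0, Real.exp (q * s) * H (u s) x) := by
  change Real.exp _ * (f x + (∫ s in (0 : ℝ)..max t 0, Real.exp (q * s) • H (u s)) x) = _
  rw [intervalIntegral_apply (h.continuous_integrand hu)]
  rfl

lemma IsMonotoneReaction.continuous_integrand_apply (h : IsMonotoneReaction E θ q H)
    {u : ℝ → Cb d} (hu : IsPath E θ u) (x : Space d) :
    Continuous fun s => Real.exp (q * s) * H (u s) x :=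
  continuous_apply_path (h.continuous_integrand hu) x

lemma exp_mul_integral (q θ t : ℝ) :
    Real.exp (-(q * t)) * (θ + ∫ s in (0 : ℝ)..t, Real.exp (q * s) * (q * θ)) = θ := by
  have h1 : ∫ s in (0 : ℝ)..t, Real.exp (q * s) * (q * θ) = θ * (Real.exp (q * t) - 1) := by
    have hd : ∀ s ∈ uIcc 0 t, HasDerivAt (fun s => θ * Real.exp (q * s))
        (Real.exp (q * s) * (q * θ)) s := fun s _ => by
      have := (((hasDerivAt_id s).const_mul q).exp).const_mul θ
      exact this.congr_deriv (by simp only [id]; ring)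
    rw [intervalIntegral.integral_eq_sub_of_hasDerivAt hd
      ((by fun_prop : Continuous fun s => Real.exp (q * s) * (q * θ)).intervalIntegrable _ _)]
    simp; ring
  rw [h1, Real.exp_neg]
  field_simp
  ring

lemma IsMonotoneReaction.duhamel_isPath (h : IsMonotoneReaction E θ q H) {u : ℝ → Cb d}
    (hu : IsPath E θ u) {f : Cb d} (hf : f ∈ tube E θ) : IsPath E θ (duhamel q H f u) := by
  have hc := h.continuous_integrand hu
  have hm : Continuous fun t : ℝ => max t 0 := continuous_id.max continuous_const
  refine ⟨?_, fun t => ⟨?_, fun x => ?_⟩⟩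
  · exact (by fun_prop : Continuous fun t : ℝ => Real.exp (-(q * max t 0))).smul
      (continuous_const.add ((intervalIntegral.continuous_primitive
        (fun a b => hc.intervalIntegrable a b) 0).comp hm))
  · exact smul_mem' h.phase (add_mem' h.phase hf.1 (intervalIntegral_mem h.phase hc
      (fun s => smul_mem' h.phase (h.mem _ (hu.2 s)) _) _ _)) _
  · rw [h.duhamel_apply hu]
    have ht : (0 : ℝ) ≤ max t 0 := le_max_right _ _
    have hci := h.continuous_integrand_apply hu x
    constructor
    · refine mul_nonneg (Real.exp_pos _).le (add_nonneg (hf.2 x).1 ?_)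
      exact intervalIntegral.integral_nonneg ht fun s _ =>
        mul_nonneg (Real.exp_pos _).le (h.bounds (hu.2 s) x).1
    · rw [← exp_mul_integral q θ (max t 0)]
      gcongr
      · exact (hf.2 x).2
      · refine intervalIntegral.integral_mono_on ht (hci.intervalIntegrable _ _)
          ((by fun_prop : Continuous fun s => Real.exp (q * s) * (q * θ)).intervalIntegrable _ _)
          fun s _ => ?_
        gcongr
        exact (h.bounds (hu.2 s) x).2

lemma IsMonotoneReaction.duhamel_mono (h : IsMonotoneReaction E θ q H) {u w : ℝ → Cb d}
    (hu : IsPath E θ u) (hw : IsPath E θ w) (huw : ∀ t x, u t x ≤ w t x) {f g : Cb d}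
    (hfg : ∀ x, f x ≤ g x) (t : ℝ) (x : Space d) :
    duhamel q H f u t x ≤ duhamel q H g w t x := by
  rw [h.duhamel_apply hu, h.duhamel_apply hw]
  gcongr
  · exact hfg x
  · refine intervalIntegral.integral_mono_on (le_max_right _ _)
      ((h.continuous_integrand_apply hu x).intervalIntegrable _ _)
      ((h.continuous_integrand_apply hw x).intervalIntegrable _ _) fun s _ => ?_
    gcongr
    exact h.mono _ (hu.2 s) _ (hw.2 s) (huw s) x

lemma IsMonotoneReaction.duhamel_translate (h : IsMonotoneReaction E θ q H) {u : ℝ → Cb d}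
    (hu : IsPath E θ u) (y : Space d) (hu' : IsPath E θ fun t => translate y (u t)) (f : Cb d)
    (t : ℝ) : duhamel q H (translate y f) (fun t => translate y (u t)) t =
      translate y (duhamel q H f u t) := by
  ext x
  change _ = duhamel q H f u t (x - y)
  rw [h.duhamel_apply hu', h.duhamel_apply hu]
  simp only [h.transl y _ (hu.2 _), translate_apply]

lemma IsMonotoneReaction.duhamel_locConv (h : IsMonotoneReaction E θ q H)
    {u : ℕ → ℝ → Cb d} {w : ℝ → Cb d} (hu : ∀ n, IsPath E θ (u n)) (hw : IsPath E θ w)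
    (huw : ∀ t, LocConv (fun n => u n t) (w t)) {f : ℕ → Cb d} {g : Cb d} (hfg : LocConv f g)
    (t : ℝ) : LocConv (fun n => duhamel q H (f n) (u n) t) (duhamel q H g w t) := by
  intro x
  simp only [h.duhamel_apply (hu _), h.duhamel_apply hw]
  refine ((hfg x).add ?_).const_mul _
  refine intervalIntegral.tendsto_integral_filter_of_dominated_convergence
    (fun s => Real.exp (q * s) * (q * θ))
    (Eventually.of_forall fun p => (h.continuous_integrand_apply (hu _) _).aestronglyMeasurable)
    (Eventually.of_forall fun p => Eventually.of_forall fun s _ => ?_)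
    ((by fun_prop : Continuous fun s => Real.exp (q * s) * (q * θ)).intervalIntegrable _ _)
    (Eventually.of_forall fun s _ => ?_)
  · have hb := h.bounds ((hu p.1).2 s) p.2
    rw [Real.norm_eq_abs, abs_of_nonneg (mul_nonneg (Real.exp_pos _).le hb.1)]
    gcongr
    exact hb.2
  · exact (h.cont _ _ (fun n => (hu n).2 s) (hw.2 s) (huw s) x).const_mul _

/-- The Duhamel map contracts by the factor `1/2` in the norm with the weight `e^{-2Kt}`. -/
lemma IsMonotoneReaction.duhamel_contract (h : IsMonotoneReaction E θ q H) {K : ℝ} (hK : 0 < K)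
    (hl : ∀ v ∈ tube E θ, ∀ w ∈ tube E θ, ‖H v - H w‖ ≤ K * ‖v - w‖) {u w : ℝ → Cb d}
    (hu : IsPath E θ u) (hw : IsPath E θ w) {D : ℝ} (hD : 0 ≤ D)
    (huw : ∀ t, 0 ≤ t → ‖u t - w t‖ ≤ D * Real.exp (2 * K * t)) (f : Cb d) (t : ℝ) :
    ‖duhamel q H f u t - duhamel q H f w t‖ ≤ D / 2 * Real.exp (2 * K * max t 0) := by
  set T := max t 0
  have hT : 0 ≤ T := le_max_right _ _
  have hcu := h.continuous_integrand hu
  have hcw := h.continuous_integrand hw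
  have h1 : duhamel q H f u t - duhamel q H f w t =
      ∫ s in (0 : ℝ)..T, Real.exp (-(q * T)) • (Real.exp (q * s) • (H (u s) - H (w s))) := by
    rw [intervalIntegral.integral_smul]
    simp only [smul_sub]
    rw [intervalIntegral.integral_sub (hcu.intervalIntegrable _ _) (hcw.intervalIntegrable _ _)]
    rw [duhamel, duhamel]
    module
  have h2 : ∀ s ∈ Ioc 0 T, ‖Real.exp (-(q * T)) • (Real.exp (q * s) • (H (u s) - H (w s)))‖ ≤
      K * D * Real.exp (2 * K * s) := fun s hs => by
    rw [smul_smul, ← Real.exp_add, norm_smul, Real.norm_eq_abs, abs_of_pos (Real.exp_pos _)]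
    have he : Real.exp (-(q * T) + q * s) ≤ 1 := by
      rw [Real.exp_le_one_iff]
      nlinarith [h.q_pos, hs.2]
    calc _ ≤ 1 * ‖H (u s) - H (w s)‖ := by gcongr
      _ ≤ 1 * (K * (D * Real.exp (2 * K * s))) := by
        gcongr
        exact (hl _ (hu.2 s) _ (hw.2 s)).trans (by gcongr; exact huw s hs.1.le)
      _ = _ := by ring
  have hcont : Continuous fun s => K * D * Real.exp (2 * K * s) := by fun_prop
  rw [h1]
  refine (intervalIntegral.norm_integral_le_of_norm_le hT (Eventually.of_forall h2)
    (hcont.intervalIntegrable _ _)).trans ?_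
  have hd : ∀ s ∈ uIcc 0 T, HasDerivAt (fun s => D / 2 * Real.exp (2 * K * s))
      (K * D * Real.exp (2 * K * s)) s := fun s _ => by
    have := (((hasDerivAt_id s).const_mul (2 * K)).exp).const_mul (D / 2)
    exact this.congr_deriv (by simp only [id]; ring)
  rw [intervalIntegral.integral_eq_sub_of_hasDerivAt hd (hcont.intervalIntegrable _ _)]
  simp only [mul_zero, Real.exp_zero, mul_one]
  linarith

/-- The Picard iterates of `u' = -q u + H u`, `u(0) = f`. -/
def picard (q : ℝ) (H : Cb d → Cb d) (f : Cb d) : ℕ → ℝ → Cb d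
  | 0 => fun _ => f
  | n + 1 => duhamel q H f (picard q H f n)

lemma IsMonotoneReaction.picard_isPath (h : IsMonotoneReaction E θ q H) {f : Cb d}
    (hf : f ∈ tube E θ) (n : ℕ) : IsPath E θ (picard q H f n) := by
  induction n with
  | zero => exact ⟨continuous_const, fun _ => hf⟩
  | succ n ih => exact h.duhamel_isPath ih hf

/-- The solution of `u' = -q u + H u`, `u(0) = f`, as the limit of the Picard iterates. -/
def flow (q : ℝ) (H : Cb d → Cb d) (t : ℝ) (f : Cb d) : Cb d :=
  limUnder atTop fun n => picard q H f n t

/-- Any solution of the integrated equation is approximated by the Picard iterates. -/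
lemma IsMonotoneReaction.norm_picard_sub_le (h : IsMonotoneReaction E θ q H) {K : ℝ}
    (hK : 0 < K) (hl : ∀ v ∈ tube E θ, ∀ w ∈ tube E θ, ‖H v - H w‖ ≤ K * ‖v - w‖)
    {f : Cb d} (hf : f ∈ tube E θ) {w : ℝ → Cb d} (hw : IsPath E θ w)
    (hfix : ∀ t, 0 ≤ t → w t = duhamel q H f w t) (n : ℕ) (t : ℝ) (ht : 0 ≤ t) :
    ‖picard q H f n t - w t‖ ≤ θ / 2 ^ n * Real.exp (2 * K * t) := by
  induction n generalizing t with
  | zero =>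
    rw [pow_zero, div_one]
    refine (norm_sub_le_of_mem_tube h.top_pos.le hf (hw.2 t)).trans ?_
    exact le_mul_of_one_le_right h.top_pos.le (Real.one_le_exp (by positivity))
  | succ n ih =>
    rw [hfix t ht]
    have := h.duhamel_contract hK hl (h.picard_isPath hf n) hw
      (div_nonneg h.top_pos.le (by positivity)) ih f t
    rw [max_eq_left ht] at this
    rw [pow_succ, ← div_div]
    exact this

lemma IsMonotoneReaction.norm_picard_succ_sub_le (h : IsMonotoneReaction E θ q H) {K : ℝ}
    (hK : 0 < K) (hl : ∀ v ∈ tube E θ, ∀ w ∈ tube E θ, ‖H v - H w‖ ≤ K * ‖v - w‖)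
    {f : Cb d} (hf : f ∈ tube E θ) (n : ℕ) (t : ℝ) :
    ‖picard q H f n t - picard q H f (n + 1) t‖ ≤ θ / 2 ^ n * Real.exp (2 * K * max t 0) := by
  induction n generalizing t with
  | zero =>
    rw [pow_zero, div_one]
    refine (norm_sub_le_of_mem_tube h.top_pos.le hf ((h.picard_isPath hf 1).2 t)).trans ?_
    exact le_mul_of_one_le_right h.top_pos.le
      (Real.one_le_exp (mul_nonneg (by positivity) (le_max_right _ _)))
  | succ n ih =>
    rw [pow_succ, ← div_div]
    refine h.duhamel_contract hK hl (h.picard_isPath hf n) (h.picard_isPath hf (n + 1))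
      (div_nonneg h.top_pos.le (by positivity)) (fun s hs => ?_) f t
    have := ih s
    rwa [max_eq_left hs] at this

lemma IsMonotoneReaction.exists_norm_picard_sub_flow_le (h : IsMonotoneReaction E θ q H) :
    ∃ K : ℝ, 0 < K ∧ ∀ f ∈ tube E θ, ∀ (n : ℕ) (t : ℝ),
      ‖picard q H f n t - flow q H t f‖ ≤
        2 * θ * Real.exp (2 * K * max t 0) * (1 / 2) ^ n := by
  obtain ⟨K, hK, hl⟩ := h.lip
  refine ⟨K, hK, fun f hf n t => ?_⟩
  have hdist : ∀ n, dist (picard q H f n t) (picard q H f (n + 1) t) ≤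
      θ * Real.exp (2 * K * max t 0) * (1 / 2) ^ n := fun n => by
    rw [dist_eq_norm]
    refine (h.norm_picard_succ_sub_le hK hl hf n t).trans_eq ?_
    rw [one_div, inv_pow]
    ring
  have hlim := (cauchySeq_of_le_geometric _ _ (by norm_num) hdist).tendsto_limUnder
  have := dist_le_of_le_geometric_of_tendsto _ _ (by norm_num) hdist hlim n
  rw [dist_eq_norm] at this
  refine this.trans_eq ?_
  ring

lemma IsMonotoneReaction.tendsto_picard (h : IsMonotoneReaction E θ q H) {f : Cb d}
    (hf : f ∈ tube E θ) (t : ℝ) :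
    Tendsto (fun n => picard q H f n t) atTop (𝓝 (flow q H t f)) := by
  obtain ⟨K, hK, hb⟩ := h.exists_norm_picard_sub_flow_le
  rw [tendsto_iff_norm_sub_tendsto_zero]
  refine squeeze_zero (fun _ => norm_nonneg _) (fun n => hb f hf n t) ?_
  simpa using (tendsto_pow_atTop_nhds_zero_of_lt_one (r := (1 / 2 : ℝ)) (by norm_num)
    (by norm_num)).const_mul (2 * θ * Real.exp (2 * K * max t 0))

lemma IsMonotoneReaction.tendsto_picard_apply (h : IsMonotoneReaction E θ q H) {f : Cb d}
    (hf : f ∈ tube E θ) (t : ℝ) (x : Space d) :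
    Tendsto (fun n => picard q H f n t x) atTop (𝓝 (flow q H t f x)) :=
  ((BoundedContinuousFunction.evalCLM ℝ x).continuous.tendsto _).comp (h.tendsto_picard hf t)

lemma IsMonotoneReaction.flow_isPath (h : IsMonotoneReaction E θ q H) {f : Cb d}
    (hf : f ∈ tube E θ) : IsPath E θ fun t => flow q H t f := by
  refine ⟨?_, fun t => (isClosed_tube h.phase θ).mem_of_tendsto (h.tendsto_picard hf t)
    (Eventually.of_forall fun n => (h.picard_isPath hf n).2 t)⟩
  obtain ⟨K, hK, hb⟩ := h.exists_norm_picard_sub_flow_le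
  have hlu : TendstoLocallyUniformly (fun n t => picard q H f n t) (fun t => flow q H t f)
      atTop := by
    refine Metric.tendstoLocallyUniformly_iff.2 fun ε hε t => ⟨Iic (t + 1),
      Iic_mem_nhds (by linarith), ?_⟩
    have := (tendsto_pow_atTop_nhds_zero_of_lt_one (r := (1 / 2 : ℝ)) (by norm_num)
      (by norm_num)).const_mul (2 * θ * Real.exp (2 * K * max (t + 1) 0))
    rw [mul_zero] at this
    filter_upwards [this.eventually (gt_mem_nhds hε)] with n hn s hs
    rw [dist_comm, dist_eq_norm]
    refine (hb f hf n s).trans_lt (lt_of_le_of_lt ?_ hn)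
    have := h.top_pos
    gcongr
    exact hs
  exact hlu.continuous (Frequently.of_forall fun n => (h.picard_isPath hf n).1)

lemma IsMonotoneReaction.flow_eq_duhamel (h : IsMonotoneReaction E θ q H) {f : Cb d}
    (hf : f ∈ tube E θ) (t : ℝ) : flow q H t f = duhamel q H f (fun t => flow q H t f) t := by
  refine tendsto_nhds_unique ((h.tendsto_picard hf t).comp (tendsto_add_atTop_nat 1)) ?_
  obtain ⟨K, hK, hl⟩ := h.lip
  obtain ⟨K', hK', hb⟩ := h.exists_norm_picard_sub_flow_le
  rw [tendsto_iff_norm_sub_tendsto_zero]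
  -- the two constants are compared through their maximum
  set M := max K K'
  have hM : 0 < M := hK.trans_le (le_max_left _ _)
  have hlM : ∀ v ∈ tube E θ, ∀ w ∈ tube E θ, ‖H v - H w‖ ≤ M * ‖v - w‖ := fun v hv w hw =>
    (hl v hv w hw).trans (by gcongr; exact le_max_left _ _)
  have key : ∀ n, ‖picard q H f (n + 1) t - duhamel q H f (fun t => flow q H t f) t‖ ≤
      2 * θ * (1 / 2) ^ n / 2 * Real.exp (2 * M * max t 0) := fun n => by
    have hθ := h.top_pos
    refine h.duhamel_contract hM hlM (h.picard_isPath hf n) (h.flow_isPath hf) (by positivity)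
      (fun s hs => (hb f hf n s).trans ?_) f t
    rw [max_eq_left hs, mul_right_comm]
    gcongr
    exact le_max_right _ _
  refine squeeze_zero (fun _ => norm_nonneg _) key ?_
  simpa using (((tendsto_pow_atTop_nhds_zero_of_lt_one (r := (1 / 2 : ℝ)) (by norm_num)
    (by norm_num)).const_mul (2 * θ)).div_const 2).mul_const (Real.exp (2 * M * max t 0))

/-- Uniqueness for the integrated equation. -/
lemma IsMonotoneReaction.eq_flow (h : IsMonotoneReaction E θ q H) {f : Cb d}
    (hf : f ∈ tube E θ) {w : ℝ → Cb d} (hw : IsPath E θ w)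
    (hfix : ∀ t, 0 ≤ t → w t = duhamel q H f w t) (t : ℝ) (ht : 0 ≤ t) :
    w t = flow q H t f := by
  obtain ⟨K, hK, hl⟩ := h.lip
  refine tendsto_nhds_unique ?_ (h.tendsto_picard hf t)
  rw [tendsto_iff_norm_sub_tendsto_zero]
  refine squeeze_zero (fun _ => norm_nonneg _)
    (fun n => h.norm_picard_sub_le hK hl hf hw hfix n t ht) ?_
  have := ((tendsto_pow_atTop_nhds_zero_of_lt_one (r := (1 / 2 : ℝ)) (by norm_num)
    (by norm_num)).const_mul θ).mul_const (Real.exp (2 * K * t))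
  simpa [div_eq_mul_inv] using this

lemma IsMonotoneReaction.flow_mono (h : IsMonotoneReaction E θ q H) {f g : Cb d}
    (hf : f ∈ tube E θ) (hg : g ∈ tube E θ) (hfg : ∀ x, f x ≤ g x) (t : ℝ) (x : Space d) :
    flow q H t f x ≤ flow q H t g x := by
  have key : ∀ n t x, picard q H f n t x ≤ picard q H g n t x := fun n => by
    induction n with
    | zero => exact fun _ => hfg
    | succ n ih => exact h.duhamel_mono (h.picard_isPath hf n) (h.picard_isPath hg n) ih hfg
  exact le_of_tendsto_of_tendsto' (h.tendsto_picard_apply hf t x) (h.tendsto_picard_apply hg t x)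
    fun n => key n t x

lemma IsMonotoneReaction.flow_translate (h : IsMonotoneReaction E θ q H) {f : Cb d}
    (hf : f ∈ tube E θ) (y : Space d) (t : ℝ) :
    flow q H t (translate y f) = translate y (flow q H t f) := by
  have hy := translate_mem_tube h.phase hf y
  have key : ∀ n, picard q H (translate y f) n = fun t => translate y (picard q H f n t) :=
    fun n => by
      induction n with
      | zero => rfl
      | succ n ih =>
        funext t
        have := h.picard_isPath hy n
        rw [ih] at this
        have h2 := h.duhamel_translate (h.picard_isPath hf n) y this f t
        rw [← ih] at h2
        exact h2
  ext x
  refine tendsto_nhds_unique (h.tendsto_picard_apply hy t x) ?_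
  simp only [key, translate_apply]
  exact h.tendsto_picard_apply hf t (x - y)

lemma IsMonotoneReaction.flow_locConv (h : IsMonotoneReaction E θ q H) {f : ℕ → Cb d} {g : Cb d}
    (hf : ∀ n, f n ∈ tube E θ) (hg : g ∈ tube E θ) (hfg : LocConv f g) (t : ℝ) :
    LocConv (fun n => flow q H t (f n)) (flow q H t g) := by
  have key : ∀ k t, LocConv (fun n => picard q H (f n) k t) (picard q H g k t) := fun k => by
    induction k with
    | zero => exact fun _ => hfg
    | succ k ih =>
      exact h.duhamel_locConv (fun n => h.picard_isPath (hf n) k) (h.picard_isPath hg k) ih hfg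
  obtain ⟨K, hK, hb⟩ := h.exists_norm_picard_sub_flow_le
  intro x
  rw [Metric.tendsto_nhds]
  intro ε hε
  have := (tendsto_pow_atTop_nhds_zero_of_lt_one (r := (1 / 2 : ℝ)) (by norm_num)
    (by norm_num)).const_mul (2 * θ * Real.exp (2 * K * max t 0))
  rw [mul_zero] at this
  obtain ⟨k, hk⟩ := (this.eventually (gt_mem_nhds (show 0 < ε / 3 by positivity))).exists
  have hclose : ∀ v ∈ tube E θ, ∀ z, |picard q H v k t z - flow q H t v z| < ε / 3 :=
    fun v hv z => ((picard q H v k t - flow q H t v).norm_coe_le_norm z).trans_lt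
      ((hb v hv k t).trans_lt hk)
  filter_upwards [Metric.tendsto_nhds.1 (key k t x) (ε / 3) (by positivity)] with p hp
  have h1 := abs_lt.1 (hclose _ (hf p.1) p.2)
  have h2 := abs_lt.1 (hclose _ hg x)
  rw [Real.dist_eq] at hp ⊢
  have h3 := abs_lt.1 hp
  rw [abs_lt]
  constructor <;> linarith [h1.1, h1.2, h2.1, h2.2, h3.1, h3.2]

lemma IsMonotoneReaction.flow_zero (h : IsMonotoneReaction E θ q H) {f : Cb d}
    (hf : f ∈ tube E θ) : flow q H 0 f = f := by
  rw [h.flow_eq_duhamel hf]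
  simp [duhamel]

lemma IsMonotoneReaction.hasDerivAt_flow (h : IsMonotoneReaction E θ q H) {f : Cb d}
    (hf : f ∈ tube E θ) {t : ℝ} (ht : 0 < t) :
    HasDerivAt (fun t => flow q H t f) (H (flow q H t f) - q • flow q H t f) t := by
  have hc := h.continuous_integrand (h.flow_isPath hf)
  set g : ℝ → Cb d := fun t => Real.exp (-(q * t)) •
    (f + ∫ s in (0 : ℝ)..t, Real.exp (q * s) • H (flow q H s f)) with hg
  have heq : ∀ s, 0 < s → flow q H s f = g s := fun s hs => by
    rw [h.flow_eq_duhamel hf, duhamel, max_eq_left hs.le]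
  have h1 : HasDerivAt (fun t => Real.exp (-(q * t))) (Real.exp (-(q * t)) * -q) t := by
    have := (((hasDerivAt_id t).const_mul q).neg).exp
    simpa using this
  have h2 := (hc.integral_hasStrictDerivAt 0 t).hasDerivAt.const_add f
  have h3 := h1.smul h2
  refine (h3.congr_of_eventuallyEq ?_).congr_deriv ?_
  · filter_upwards [lt_mem_nhds ht] with s hs using heq s hs
  · have hft := heq t ht
    simp only [hg] at hft
    rw [smul_smul, ← Real.exp_add, neg_add_cancel, Real.exp_zero, one_smul]
    generalize H (flow q H t f) = Y
    rw [hft]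
    module

end Duhamel

section Flow

variable {θ q : ℝ} {H : Cb d → Cb d}

lemma IsMonotoneReaction.eq_flow_of_hasDerivAt (h : IsMonotoneReaction E θ q H) {f : Cb d}
    {w : ℝ → Cb d} (hw : ∀ t, 0 ≤ t → w t ∈ tube E θ) (hc : ContinuousOn w (Ici 0))
    (h0 : w 0 = f) (hd : ∀ t, 0 < t → HasDerivAt w (H (w t) - q • w t) t) (t : ℝ) (ht : 0 ≤ t) :
    w t = flow q H t f := by
  have hpath : IsPath E θ fun t => w (max t 0) :=
    ⟨hc.comp_continuous (by fun_prop) fun t => le_max_right t 0, fun t => hw _ (le_max_right _ _)⟩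
  have hf : f ∈ tube E θ := h0 ▸ hw 0 le_rfl
  have key : ∀ t, 0 ≤ t → w (max t 0) = duhamel q H f (fun t => w (max t 0)) t := by
    intro t ht
    rw [duhamel, max_eq_left ht]
    have hder : ∀ s ∈ Ioo 0 t, HasDerivAt (fun s => Real.exp (q * s) • w s)
        (Real.exp (q * s) • H (w (max s 0))) s := by
      intro s hs
      have h1 : HasDerivAt (fun s => Real.exp (q * s)) (Real.exp (q * s) * q) s := by
        simpa using ((hasDerivAt_id s).const_mul q).exp
      refine (h1.smul (hd s hs.1)).congr_deriv ?_
      rw [max_eq_left hs.1.le]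
      module
    have hcz : ContinuousOn (fun s => Real.exp (q * s) • w s) (Icc 0 t) :=
      (by fun_prop : Continuous fun s : ℝ => Real.exp (q * s)).continuousOn.smul
        (hc.mono Icc_subset_Ici_self)
    rw [intervalIntegral.integral_eq_sub_of_hasDerivAt_of_le ht hcz hder
      ((h.continuous_integrand hpath).intervalIntegrable _ _), mul_zero, Real.exp_zero, one_smul,
      h0, add_sub_cancel, smul_smul, ← Real.exp_add, neg_add_cancel, Real.exp_zero, one_smul]
  have := h.eq_flow hf hpath key t ht
  rwa [max_eq_left ht] at this

lemma IsMonotoneReaction.flow_add (h : IsMonotoneReaction E θ q H) {f : Cb d}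
    (hf : f ∈ tube E θ) {s t : ℝ} (hs : 0 ≤ s) (ht : 0 ≤ t) :
    flow q H (s + t) f = flow q H t (flow q H s f) := by
  refine h.eq_flow_of_hasDerivAt (w := fun t => flow q H (s + t) f)
    (fun t _ => (h.flow_isPath hf).2 _) ?_ (by simp) (fun t ht => ?_) t ht
  · exact ((h.flow_isPath hf).1.comp (by fun_prop : Continuous fun t => s + t)).continuousOn
  · exact (h.hasDerivAt_flow hf (by linarith : 0 < s + t)).comp_const_add s t

lemma IsMonotoneReaction.flow_iterate (h : IsMonotoneReaction E θ q H) {f : Cb d}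
    (hf : f ∈ tube E θ) (n : ℕ) : (flow q H 1)^[n] f = flow q H n f := by
  induction n with
  | zero => simp [h.flow_zero hf]
  | succ n ih =>
    rw [Function.iterate_succ_apply', ih, ← h.flow_add hf n.cast_nonneg zero_le_one]
    push_cast
    rfl

lemma IsMonotoneReaction.flow_top (h : IsMonotoneReaction E θ q H) {t : ℝ} (ht : 0 ≤ t) :
    flow q H t (constFun d θ) = constFun d θ := by
  have hθ := const_mem_tube h.phase h.top_pos.le (le_refl θ)
  refine (h.eq_flow_of_hasDerivAt (w := fun _ => constFun d θ) (fun _ _ => hθ)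
    continuousOn_const rfl (fun s _ => ?_) t ht).symm
  refine (hasDerivAt_const s _).congr_deriv ?_
  rw [h.map_top]
  ext x
  simp

/-- The flow is Lipschitz continuous in time, uniformly in the initial condition. -/
lemma IsMonotoneReaction.norm_flow_sub_le (h : IsMonotoneReaction E θ q H) {f : Cb d}
    (hf : f ∈ tube E θ) {s t : ℝ} (hs : 0 < s) (ht : 0 < t) :
    ‖flow q H t f - flow q H s f‖ ≤ q * θ * |t - s| := by
  refine Convex.norm_image_sub_le_of_norm_hasDerivWithin_le (s := Ioi 0)
    (f := fun t => flow q H t f) (f' := fun r => H (flow q H r f) - q • flow q H r f)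
    (fun r hr => (h.hasDerivAt_flow hf hr).hasDerivWithinAt) (fun r _ => ?_) (convex_Ioi 0) hs ht
  have hv := (h.flow_isPath hf).2 r
  have hq := h.q_pos
  rw [BoundedContinuousFunction.norm_le (mul_nonneg hq.le h.top_pos.le)]
  intro x
  change |H (flow q H r f) x - q * flow q H r f x| ≤ _
  have hb := h.bounds hv x
  rw [abs_le]
  constructor <;> nlinarith [hv.2 x]

/-- Order preserving translation invariant maps of `{v ∈ E : 0 ≤ v ≤ θ}` that fix `θ` and are
continuous for locally uniform convergence. -/
structure IsMonotoneEvolution (E : Set (Cb d)) (θ : ℝ) (P : Cb d → Cb d) : Prop where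
  phase : E = univ ∨ E = Buc d
  top_pos : 0 < θ
  mem : ∀ v ∈ tube E θ, P v ∈ tube E θ
  mono : ∀ v ∈ tube E θ, ∀ w ∈ tube E θ, (∀ x, v x ≤ w x) → ∀ x, P v x ≤ P w x
  transl : ∀ y, ∀ v ∈ tube E θ, P (translate y v) = translate y (P v)
  cont : ∀ (v : ℕ → Cb d) (w : Cb d), (∀ n, v n ∈ tube E θ) → w ∈ tube E θ → LocConv v w →
    LocConv (fun n => P (v n)) (P w)
  map_top : P (constFun d θ) = constFun d θ

lemma IsMonotoneReaction.flow_isMonotoneEvolution (h : IsMonotoneReaction E θ q H) {t : ℝ}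
    (ht : 0 ≤ t) : IsMonotoneEvolution E θ (flow q H t) where
  phase := h.phase
  top_pos := h.top_pos
  mem _ hv := (h.flow_isPath hv).2 t
  mono _ hv _ hw hvw := h.flow_mono hv hw hvw t
  transl y _ hv := h.flow_translate hv y t
  cont _ _ hv hw hvw := h.flow_locConv hv hw hvw t
  map_top := h.flow_top ht

lemma IsMonotoneEvolution.map_const {P : Cb d → Cb d} (hP : IsMonotoneEvolution E θ P)
    {r : ℝ} (h0 : 0 ≤ r) (h1 : r ≤ θ) : P (constFun d r) = constFun d (P (constFun d r) 0) := by
  ext x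
  have := hP.transl x _ (const_mem_tube hP.phase h0 h1)
  have h2 : translate x (constFun d r) = constFun d r := rfl
  rw [h2] at this
  have h3 := DFunLike.congr_fun this x
  rwa [translate_apply, sub_self] at h3

lemma hasDerivAt_apply {u : ℝ → Cb d} {u' : Cb d} {t : ℝ} (h : HasDerivAt u u' t) (x : Space d) :
    HasDerivAt (fun t => u t x) (u' x) t :=
  (BoundedContinuousFunction.evalCLM ℝ x : Cb d →L[ℝ] ℝ).hasFDerivAt.comp_hasDerivAt t h

/-- A positive constant below `θ` is driven to `θ`. -/
lemma IsMonotoneReaction.tendsto_flow_const (h : IsMonotoneReaction E θ q H)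
    (hgrow : ∀ r, 0 < r → r < θ → ∀ x, q * r < H (constFun d r) x) {r : ℝ} (h0 : 0 < r)
    (h1 : r < θ) : Tendsto (fun n : ℕ => flow q H n (constFun d r) 0) atTop (𝓝 θ) := by
  have hle : ∀ r, 0 ≤ r → r ≤ θ → q * r ≤ H (constFun d r) 0 := by
    intro r h0 h1
    rcases h0.eq_or_lt with rfl | h0
    · simp [h.map_zero]
    rcases h1.eq_or_lt with rfl | h1
    · simp [h.map_top]
    · exact (hgrow r h0 h1 0).le
  have hmem : ∀ r, 0 ≤ r → r ≤ θ → constFun d r ∈ tube E θ := fun r => const_mem_tube h.phase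
  have hconst : ∀ r, 0 ≤ r → r ≤ θ → ∀ t, 0 ≤ t →
      flow q H t (constFun d r) = constFun d (flow q H t (constFun d r) 0) := fun r h0 h1 t ht =>
    (h.flow_isMonotoneEvolution ht).map_const h0 h1
  have hder : ∀ r, 0 ≤ r → r ≤ θ → ∀ t, 0 < t → HasDerivAt (fun t => flow q H t (constFun d r) 0)
      (H (flow q H t (constFun d r)) 0 - q * flow q H t (constFun d r) 0) t :=
    fun r h0 h1 t ht => hasDerivAt_apply (h.hasDerivAt_flow (hmem r h0 h1) ht) 0
  have hmono : ∀ r, 0 ≤ r → r ≤ θ →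
      MonotoneOn (fun t => flow q H t (constFun d r) 0) (Ici 0) := by
    intro r h0 h1
    have hpath := h.flow_isPath (hmem r h0 h1)
    refine monotoneOn_of_deriv_nonneg (convex_Ici 0)
      (continuous_apply_path hpath.1 0).continuousOn ?_ ?_
    · rw [interior_Ici]
      exact fun t ht => (hder r h0 h1 t ht).differentiableAt.differentiableWithinAt
    · rw [interior_Ici]
      intro t ht
      rw [(hder r h0 h1 t ht).deriv, hconst r h0 h1 t (le_of_lt ht)]
      have hb := (hpath.2 t).2 0
      exact sub_nonneg.2 (hle _ hb.1 hb.2)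
  set ρ : ℕ → ℝ := fun n => flow q H n (constFun d r) 0 with hρ
  have hρmono : Monotone ρ := fun i j hij => hmono r h0.le h1.le (mem_Ici.2 i.cast_nonneg)
    (mem_Ici.2 j.cast_nonneg) (Nat.cast_le.2 hij)
  have hρb : ∀ n, ρ n ≤ θ := fun n => (((h.flow_isPath (hmem r h0.le h1.le)).2 n).2 0).2
  have hρ0 : ρ 0 = r := by simp [hρ, h.flow_zero (hmem r h0.le h1.le)]
  have hlim := tendsto_atTop_ciSup hρmono ⟨θ, by rintro _ ⟨n, rfl⟩; exact hρb n⟩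
  set L := ⨆ n, ρ n
  have hLθ : L ≤ θ := le_of_tendsto' hlim hρb
  have hL0 : 0 < L := h0.trans_le (hρ0 ▸ hρmono.ge_of_tendsto hlim 0)
  rcases hLθ.eq_or_lt with hL | hL
  · rwa [hL] at hlim
  -- the limit is a fixed point of the time-one map, which is impossible strictly below `θ`
  exfalso
  have hfix : flow q H 1 (constFun d L) 0 = L := by
    have hc : LocConv (fun n => flow q H n (constFun d r)) (constFun d L) := by
      intro x
      have : ∀ p : ℕ × Space d, flow q H p.1 (constFun d r) p.2 = ρ p.1 := fun p => by
        rw [hconst r h0.le h1.le p.1 p.1.cast_nonneg]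
        rfl
      simp only [this]
      exact hlim.comp tendsto_fst
    have h2 := (h.flow_locConv (fun n => (h.flow_isPath (hmem r h0.le h1.le)).2 n)
      (hmem L hL0.le hLθ) hc 1).tendsto_apply 0
    refine tendsto_nhds_unique h2 ((hlim.comp (tendsto_add_atTop_nat 1)).congr fun n => ?_)
    simp only [Function.comp, hρ]
    rw [← h.flow_add (hmem r h0.le h1.le) n.cast_nonneg zero_le_one]
    push_cast
    rfl
  have hLm := hmem L hL0.le hLθ
  have hconstL : ∀ t ∈ Ioo (0 : ℝ) 1, flow q H t (constFun d L) 0 = L := by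
    intro t ht
    refine le_antisymm ?_ ?_
    · have := hmono L hL0.le hLθ (mem_Ici.2 ht.1.le) (mem_Ici.2 zero_le_one) ht.2.le
      simp only at this
      rwa [hfix] at this
    · have := hmono L hL0.le hLθ (mem_Ici.2 le_rfl) (mem_Ici.2 ht.1.le) ht.1.le
      simp only at this
      rwa [h.flow_zero hLm] at this
  have hhalf : (1 / 2 : ℝ) ∈ Ioo (0 : ℝ) 1 := by norm_num
  have hd := hder L hL0.le hLθ (1 / 2) (by norm_num)
  have hd0 : HasDerivAt (fun t => flow q H t (constFun d L) 0) 0 (1 / 2) := by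
    refine (hasDerivAt_const (1 / 2 : ℝ) L).congr_of_eventuallyEq ?_
    filter_upwards [Ioo_mem_nhds hhalf.1 hhalf.2] with t ht using hconstL t ht
  have := hd.unique hd0
  rw [hconst L hL0.le hLθ _ hhalf.1.le, hconstL _ hhalf] at this
  have h3 := hgrow L hL0 hL 0
  simp only [constFun_apply] at this
  linarith

end Flow

/-! ### The nonlocal reaction-diffusion equation -/

section Equation

variable {a : Space d → ℝ} {κ m θ : ℝ} {G : Cb d → Cb d}

/-- After adding a multiple of `u` to both sides, the equation becomes order preserving. -/
lemma Assumptions.exists_isMonotoneReaction (hE : E = univ ∨ E = Buc d)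
    (ha : IsProbabilityKernel a) (hκ : 0 < κ) (hm : 0 < m) (hA : Assumptions E a κ m θ G) :
    ∃ (q : ℝ) (H : Cb d → Cb d), IsMonotoneReaction E θ q H ∧
      ∀ v x, H v x - q * v x = κ * conv a v x - m * v x - v x * G v x := by
  obtain ⟨p, hp, hmono⟩ := hA.quasi_monotone
  have hθ := hA.theta_pos
  refine ⟨m + p, fun v => κ • convB a ha v - v * G v + p • v, ⟨hE, by positivity, hθ, ?_, ?_,
    ?_, ?_, ?_, ?_, ?_⟩, ?_⟩
  · intro v hv
    exact add_mem' hE (sub_mem' hE (smul_mem' hE (convB_mem hE a ha hv.1) _)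
      (mul_mem' hE hv.1 (hA.mapsTo hv))) (smul_mem' hE hv.1 _)
  · obtain ⟨l, hl, hlip⟩ := hA.lipschitz
    have hβ := hA.beta_pos
    refine ⟨κ + ((κ - m) + θ * l) + p, by positivity, fun v hv w hw => ?_⟩
    have hsplit : (κ • convB a ha v - v * G v + p • v) - (κ • convB a ha w - w * G w + p • w) =
        κ • convB a ha (v - w) - ((v - w) * G v + w * (G v - G w)) + p • (v - w) := by
      rw [convB_sub]
      ext x
      simp only [BoundedContinuousFunction.coe_sub, BoundedContinuousFunction.coe_add,
        BoundedContinuousFunction.coe_mul, BoundedContinuousFunction.coe_smul, Pi.sub_apply,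
        Pi.add_apply, Pi.mul_apply, smul_eq_mul]
      ring
    have hGv : ‖G v‖ ≤ κ - m := by
      rw [BoundedContinuousFunction.norm_le hβ.le]
      intro x
      rw [Real.norm_eq_abs, abs_of_nonneg (hA.bounds v hv x).1]
      exact (hA.bounds v hv x).2
    have h1 : ‖κ • convB a ha (v - w)‖ ≤ κ * ‖v - w‖ := by
      rw [norm_smul, Real.norm_eq_abs, abs_of_pos hκ]
      gcongr
      exact norm_convB_le a ha _
    have h2 : ‖(v - w) * G v‖ ≤ ‖v - w‖ * (κ - m) :=
      (norm_mul_le _ _).trans (by gcongr)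
    have h3 : ‖w * (G v - G w)‖ ≤ θ * (l * ‖v - w‖) :=
      (norm_mul_le _ _).trans (mul_le_mul (norm_le_of_mem_tube hθ.le hw) (hlip v hv w hw)
        (norm_nonneg _) hθ.le)
    have h4 : ‖p • (v - w)‖ = p * ‖v - w‖ := by
      rw [norm_smul, Real.norm_eq_abs, abs_of_nonneg hp]
    rw [hsplit]
    refine (norm_add_le _ _).trans ((add_le_add (norm_sub_le _ _) le_rfl).trans ?_)
    have h5 := norm_add_le ((v - w) * G v) (w * (G v - G w))
    linarith
  · intro v hv w hw hvw x
    exact hmono v hv w hw hvw x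
  · simp only [convB_const, hA.map_zero]
    ext x
    simp
  · simp only [convB_const, hA.map_theta]
    ext x
    simp only [BoundedContinuousFunction.coe_sub, BoundedContinuousFunction.coe_add,
        BoundedContinuousFunction.coe_mul, BoundedContinuousFunction.coe_smul, Pi.sub_apply,
        Pi.add_apply, Pi.mul_apply, smul_eq_mul, constFun_apply]
    ring
  · intro y v hv
    simp only [convB_translate, ← hA.translation_invariant y v hv]
    rfl
  · intro v w hv hw hvw
    have h1 := hvw.convB ha fun n => norm_le_of_mem_tube hθ.le (hv n)
    have h2 := locConv_iff_locUnifConv.2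
      (hA.locally_continuous v w hv hw (locConv_iff_locUnifConv.1 hvw))
    intro x
    exact (((h1 x).const_mul κ).sub ((hvw x).mul (h2 x))).add ((hvw x).const_mul p)
  · intro v x
    simp only [BoundedContinuousFunction.coe_sub, BoundedContinuousFunction.coe_add,
        BoundedContinuousFunction.coe_mul, BoundedContinuousFunction.coe_smul, Pi.sub_apply,
        Pi.add_apply, Pi.mul_apply, smul_eq_mul, convB_apply]
    ring

variable {q : ℝ} {H : Cb d → Cb d}

lemma IsMonotoneReaction.isSolution_flow (h : IsMonotoneReaction E θ q H)
    (hH : ∀ v x, H v x - q * v x = κ * conv a v x - m * v x - v x * G v x) {f : Cb d}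
    (hf : f ∈ tube E θ) : IsSolution E a κ m θ G f fun t => flow q H t f where
  mem_tube t _ := (h.flow_isPath hf).2 t
  initial x := by rw [h.flow_zero hf]
  continuousOn := (h.flow_isPath hf).1.continuousOn
  equation := ⟨fun t => H (flow q H t f) - q • flow q H t f,
    ((h.continuous_comp (h.flow_isPath hf)).sub
      ((h.flow_isPath hf).1.const_smul q)).continuousOn,
    fun _ ht => h.hasDerivAt_flow hf ht, fun t _ x => hH (flow q H t f) x⟩

lemma IsMonotoneReaction.isSolution_eq_flow (h : IsMonotoneReaction E θ q H)
    (hH : ∀ v x, H v x - q * v x = κ * conv a v x - m * v x - v x * G v x) {f : Cb d}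
    {w : ℝ → Cb d} (hw : IsSolution E a κ m θ G f w) (t : ℝ) (ht : 0 ≤ t) :
    w t = flow q H t f := by
  obtain ⟨u', -, hd, heq⟩ := hw.equation
  refine h.eq_flow_of_hasDerivAt hw.mem_tube hw.continuousOn
    (BoundedContinuousFunction.ext hw.initial) (fun s hs => ?_) t ht
  refine (hd s hs).congr_deriv (BoundedContinuousFunction.ext fun x => ?_)
  rw [heq s hs x]
  exact (hH (w s) x).symm

lemma IsMonotoneReaction.Q_eq_flow (h : IsMonotoneReaction E θ q H)
    (hH : ∀ v x, H v x - q * v x = κ * conv a v x - m * v x - v x * G v x) {f : Cb d}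
    (hf : f ∈ tube E θ) {t : ℝ} (ht : 0 ≤ t) : Q E a κ m θ G t f = flow q H t f := by
  have hex : ∃ u : ℝ → Cb d, IsSolution E a κ m θ G f u := ⟨_, h.isSolution_flow hH hf⟩
  rw [Q, dif_pos hex]
  funext x
  rw [h.isSolution_eq_flow hH (Classical.choose_spec hex) t ht]

lemma IsMonotoneReaction.Q_iterate_eq_flow (h : IsMonotoneReaction E θ q H)
    (hH : ∀ v x, H v x - q * v x = κ * conv a v x - m * v x - v x * G v x) {f : Cb d}
    (hf : f ∈ tube E θ) (n : ℕ) : (Q E a κ m θ G 1)^[n] f = flow q H n f := by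
  induction n with
  | zero => simp [h.flow_zero hf]
  | succ n ih =>
    rw [Function.iterate_succ_apply', ih, h.Q_eq_flow hH ((h.flow_isPath hf).2 _) zero_le_one,
      ← h.flow_add hf n.cast_nonneg zero_le_one]
    push_cast
    rfl

lemma Assumptions.lt_reaction_const (ha : IsProbabilityKernel a) (hA : Assumptions E a κ m θ G)
    (hH : ∀ v x, H v x - q * v x = κ * conv a v x - m * v x - v x * G v x) (r : ℝ) (h0 : 0 < r)
    (h1 : r < θ) (x : Space d) : q * r < H (constFun d r) x := by
  have h2 := hH (constFun d r) x
  have h3 := DFunLike.congr_fun (convB_const a ha r) x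
  rw [convB_apply, constFun_apply] at h3
  rw [h3, constFun_apply] at h2
  nlinarith [mul_lt_mul_of_pos_left (hA.const_lt r h0 h1 x) h0]

end Equation

/-! ### Monotone evolutions -/

section Evolution

variable {θ : ℝ} {P : Cb d → Cb d}

lemma LocConv.translate {v : ℕ → Cb d} {w : Cb d} (h : LocConv v w) {y : ℕ → Space d}
    {z : Space d} (hy : Tendsto y atTop (𝓝 z)) :
    LocConv (fun n => HairTrigger.translate (y n) (v n)) (HairTrigger.translate z w) := fun x =>
  (h (x - z)).comp (tendsto_fst.prodMk (tendsto_snd.sub (hy.comp tendsto_fst)))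

lemma IsMonotoneEvolution.id (hE : E = univ ∨ E = Buc d) (hθ : 0 < θ) :
    IsMonotoneEvolution E θ id :=
  ⟨hE, hθ, fun _ h => h, fun _ _ _ _ h => h, fun _ _ _ => rfl, fun _ _ _ _ h => h, rfl⟩

lemma IsMonotoneEvolution.comp {P' : Cb d → Cb d} (hP : IsMonotoneEvolution E θ P)
    (hP' : IsMonotoneEvolution E θ P') : IsMonotoneEvolution E θ (P ∘ P') where
  phase := hP.phase
  top_pos := hP.top_pos
  mem v hv := hP.mem _ (hP'.mem v hv)
  mono v hv w hw h := hP.mono _ (hP'.mem v hv) _ (hP'.mem w hw) (hP'.mono v hv w hw h)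
  transl y v hv := by
    simp only [Function.comp]
    rw [hP'.transl y v hv, hP.transl y _ (hP'.mem v hv)]
  cont v w hv hw h := hP.cont _ _ (fun n => hP'.mem _ (hv n)) (hP'.mem _ hw)
    (hP'.cont v w hv hw h)
  map_top := by simp only [Function.comp, hP'.map_top, hP.map_top]

lemma IsMonotoneEvolution.iterate (hP : IsMonotoneEvolution E θ P) (n : ℕ) :
    IsMonotoneEvolution E θ P^[n] := by
  induction n with
  | zero => exact .id hP.phase hP.top_pos
  | succ n ih =>
    rw [Function.iterate_succ]
    exact ih.comp hP

lemma IsMonotoneEvolution.translate_comp (hP : IsMonotoneEvolution E θ P) (p : Space d) :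
    IsMonotoneEvolution E θ fun v => translate p (P v) where
  phase := hP.phase
  top_pos := hP.top_pos
  mem v hv := translate_mem_tube hP.phase (hP.mem v hv) p
  mono v hv w hw h x := hP.mono v hv w hw h (x - p)
  transl y v hv := by
    rw [hP.transl y v hv]
    ext x
    simp only [translate_apply, sub_right_comm]
  cont v w hv hw h := (hP.cont v w hv hw h).translate tendsto_const_nhds
  map_top := by
    rw [hP.map_top]
    rfl

lemma tendsto_natCast_sub_norm (x : Space d) :
    Tendsto (fun q : ℕ × Space d => (q.1 : ℝ) - ‖q.2‖) (atTop ×ˢ 𝓝 x) atTop :=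
  tendsto_atTop_add_right_of_le' _ (-(‖x‖ + 1))
    (tendsto_natCast_atTop_atTop.comp tendsto_fst) (by
      have := (tendsto_snd (f := (atTop : Filter ℕ)) (g := 𝓝 x)).norm
      filter_upwards [this.eventually (gt_mem_nhds (lt_add_one ‖x‖))] with q hq
      linarith)

/-- The value `P v x` is controlled from below by the values of `v` on a large ball around `x`. -/
lemma IsMonotoneEvolution.exists_radius (hP : IsMonotoneEvolution E θ P) {α τ : ℝ}
    (h0 : 0 < α) (h1 : α ≤ θ) (hτ : τ < P (constFun d α) 0) :
    ∃ R > 0, ∃ δ > 0, ∀ v ∈ tube E θ, ∀ x, (∀ y ∈ Metric.ball x R, α - δ ≤ v y) →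
      τ ≤ P v x := by
  have hb : ∀ (j : ℕ) (x : Space d), max 0 (min (α - α / (j + 2)) (j - ‖x‖)) ≤ α := fun j x =>
    max_le h0.le ((min_le_left _ _).trans (sub_le_self _ (by positivity)))
  -- continuous approximations of `α` from below by functions with bounded support
  set w : ℕ → Cb d := fun j => BoundedContinuousFunction.ofNormedAddCommGroup
    (fun x => max 0 (min (α - α / (j + 2)) (j - ‖x‖))) (by fun_prop) α (fun x => by
      rw [Real.norm_eq_abs, abs_of_nonneg (le_max_left _ _)]
      exact hb j x) with hw
  have hwa : ∀ j x, w j x = max 0 (min (α - α / (j + 2)) (j - ‖x‖)) := fun j x => rfl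
  have hmem : ∀ j, w j ∈ tube E θ := fun j => by
    refine ⟨mem_of_uniformContinuous hP.phase ?_, fun x => ⟨le_max_left _ _, (hb j x).trans h1⟩⟩
    have hl : LipschitzWith 1 fun x : Space d => max 0 (min (α - α / (j + 2)) (j - ‖x‖)) := by
      have : LipschitzWith 1 fun x : Space d => (j : ℝ) - ‖x‖ :=
        LipschitzWith.of_dist_le_mul fun x y => by
          rw [Real.dist_eq, dist_eq_norm, NNReal.coe_one, one_mul, sub_sub_sub_cancel_left,
            norm_sub_rev]
          exact abs_norm_sub_norm_le _ _
      exact (this.const_min _).const_max _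
    exact hl.uniformContinuous
  have hconv : LocConv w (constFun d α) := by
    intro x
    have hα : Tendsto (fun j : ℕ => α - α / ((j : ℝ) + 2)) atTop (𝓝 α) := by
      have : Tendsto (fun j : ℕ => (j : ℝ) + 2) atTop atTop :=
        tendsto_atTop_add_const_right _ _ tendsto_natCast_atTop_atTop
      simpa using (this.const_div_atTop α).const_sub α
    have h2 : Tendsto (fun q : ℕ × Space d => max 0 (α - α / ((q.1 : ℝ) + 2))) (atTop ×ˢ 𝓝 x)
        (𝓝 (max 0 α)) := (tendsto_const_nhds.max hα).comp tendsto_fst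
    rw [max_eq_right h0.le] at h2
    refine h2.congr' ?_
    filter_upwards [(tendsto_natCast_sub_norm x).eventually_ge_atTop α] with q hq
    rw [hwa, min_eq_left]
    exact (sub_le_self _ (by positivity)).trans hq
  obtain ⟨j, hj⟩ := (((hP.cont w _ hmem (const_mem_tube hP.phase h0.le h1) hconv).tendsto_apply
    0).eventually (lt_mem_nhds hτ)).exists
  refine ⟨j + 1, by positivity, α / (j + 2), by positivity, fun v hv x hx => ?_⟩
  have hle : ∀ y, translate x (w j) y ≤ v y := fun y => by
    rw [translate_apply, hwa]
    by_cases hy : y ∈ Metric.ball x (j + 1 : ℝ)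
    · refine max_le (hv.2 y).1 ((min_le_left _ _).trans (hx y hy))
    · refine max_le (hv.2 y).1 ((min_le_right _ _).trans ?_)
      rw [Metric.mem_ball, not_lt, dist_eq_norm] at hy
      linarith [(hv.2 y).1]
  have := hP.mono _ (translate_mem_tube hP.phase (hmem j) x) v hv hle x
  rw [hP.transl x _ (hmem j), translate_apply, sub_self] at this
  exact hj.le.trans this

end Evolution

/-! ### Planar and radial fronts -/

/-- Non-increasing bounded uniformly continuous profiles with values in `[0, l]`, `l < θ`, that
vanish on `[0, ∞)` but not identically. -/
structure IsFrontProfile (Φ : ℝ →ᵇ ℝ) (l θ : ℝ) : Prop where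
  uniformContinuous : UniformContinuous Φ
  antitone : Antitone Φ
  eq_zero : ∀ s, 0 ≤ s → Φ s = 0
  le : ∀ s, Φ s ≤ l
  lt : l < θ
  exists_pos : ∃ s, 0 < Φ s

lemma cutoff_factor_nonneg (T : ℕ) : (0 : ℝ) ≤ 1 - 1 / ((T : ℝ) + 2) := by
  rw [sub_nonneg, div_le_one (by positivity)]
  linarith [T.cast_nonneg (α := ℝ)]

/-- Non-increasing cut-off functions on the line, strictly below `1`, that vanish on `[T, ∞)` and
tend to `1` as `T → ∞`. -/
def cutoff (T : ℕ) : ℝ →ᵇ ℝ :=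
  BoundedContinuousFunction.ofNormedAddCommGroup
    (fun s => (1 - 1 / ((T : ℝ) + 2)) * max 0 (min 1 (T - s))) (by fun_prop) 1 fun s => by
      have h2 : (1 : ℝ) - 1 / ((T : ℝ) + 2) ≤ 1 := sub_le_self _ (by positivity)
      have h3 : max 0 (min 1 ((T : ℝ) - s)) ≤ 1 := max_le zero_le_one (min_le_left _ _)
      rw [Real.norm_eq_abs, abs_of_nonneg (mul_nonneg (cutoff_factor_nonneg T) (le_max_left _ _))]
      exact mul_le_one₀ h2 (le_max_left _ _) h3

lemma cutoff_apply (T : ℕ) (s : ℝ) :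
    cutoff T s = (1 - 1 / ((T : ℝ) + 2)) * max 0 (min 1 (T - s)) := rfl

lemma cutoff_nonneg (T : ℕ) (s : ℝ) : 0 ≤ cutoff T s :=
  mul_nonneg (cutoff_factor_nonneg T) (le_max_left _ _)

lemma cutoff_le (T : ℕ) (s : ℝ) : cutoff T s ≤ 1 - 1 / ((T : ℝ) + 2) :=
  mul_le_of_le_one_right (cutoff_factor_nonneg T) (max_le zero_le_one (min_le_left _ _))

lemma cutoff_le_one (T : ℕ) (s : ℝ) : cutoff T s ≤ 1 :=
  (cutoff_le T s).trans (sub_le_self _ (by positivity))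

lemma cutoff_eq_zero {T : ℕ} {s : ℝ} (h : (T : ℝ) ≤ s) : cutoff T s = 0 := by
  rw [cutoff_apply, max_eq_left, mul_zero]
  exact (min_le_right _ _).trans (sub_nonpos.2 h)

lemma cutoff_antitone (T : ℕ) : Antitone (cutoff T) := fun s t h => by
  rw [cutoff_apply, cutoff_apply]
  have := cutoff_factor_nonneg T
  gcongr

lemma cutoff_uniformContinuous (T : ℕ) : UniformContinuous (cutoff T) := by
  have h1 : LipschitzWith 1 fun s : ℝ => (T : ℝ) - s :=
    LipschitzWith.of_dist_le_mul fun x y => by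
      rw [Real.dist_eq, Real.dist_eq, NNReal.coe_one, one_mul, sub_sub_sub_cancel_left,
        abs_sub_comm]
  have h2 := ((h1.const_min 1).const_max 0).uniformContinuous
  exact (uniformContinuous_const_smul (1 - 1 / ((T : ℝ) + 2))).comp h2

lemma tendsto_cutoff {ι : Type*} {F : Filter ι} {T : ι → ℕ} {s : ι → ℝ} {s₀ : ℝ}
    (hT : Tendsto T F atTop) (hs : Tendsto s F (𝓝 s₀)) :
    Tendsto (fun i => cutoff (T i) (s i)) F (𝓝 1) := by
  have hT' : Tendsto (fun i => (T i : ℝ)) F atTop := tendsto_natCast_atTop_atTop.comp hT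
  have h1 : Tendsto (fun i => 1 - 1 / ((T i : ℝ) + 2)) F (𝓝 1) := by
    simpa using ((tendsto_atTop_add_const_right _ 2 hT').const_div_atTop 1).const_sub 1
  refine h1.congr' ?_
  filter_upwards [hT'.eventually_ge_atTop (s₀ + 2), hs.eventually (gt_mem_nhds (lt_add_one s₀))]
    with i h2 h3
  rw [cutoff_apply, min_eq_left (by linarith), max_eq_right zero_le_one, mul_one]

/-- The function `x ↦ g (ρ x)`. -/
def pull (g : ℝ →ᵇ ℝ) (ρ : C(Space d, ℝ)) : Cb d := g.compContinuous ρ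

@[simp] lemma pull_apply (g : ℝ →ᵇ ℝ) (ρ : C(Space d, ℝ)) (x : Space d) :
    pull g ρ x = g (ρ x) := rfl

/-- The linear function `x ↦ x · ξ`. -/
def linearFn (ξ : Space d) : C(Space d, ℝ) := ⟨fun x => inner ℝ x ξ, by fun_prop⟩

/-- The signed distance `x ↦ ‖x‖ - s` to the sphere of radius `s`. -/
def radialFn (s : ℝ) : C(Space d, ℝ) := ⟨fun x => ‖x‖ - s, by fun_prop⟩

@[simp] lemma linearFn_apply (ξ x : Space d) : linearFn ξ x = inner ℝ x ξ := rfl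

@[simp] lemma radialFn_apply (s : ℝ) (x : Space d) : radialFn s x = ‖x‖ - s := rfl

lemma pull_linearFn_mem (hE : E = univ ∨ E = Buc d) {g : ℝ →ᵇ ℝ} (hg : UniformContinuous g)
    (ξ : Space d) : pull g (linearFn ξ) ∈ E :=
  mem_of_uniformContinuous hE (hg.comp
    ((innerSL ℝ).flip ξ).uniformContinuous)

lemma pull_radialFn_mem (hE : E = univ ∨ E = Buc d) {g : ℝ →ᵇ ℝ} (hg : UniformContinuous g)
    (s : ℝ) : pull g (radialFn s) ∈ E :=
  mem_of_uniformContinuous hE (hg.comp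
    (uniformContinuous_norm.sub uniformContinuous_const))

/-- Weinberger's iteration for a planar front with the profile `Φ`, viewed as a function on the
whole space, in the frame that moves with speed `c` in the direction `ξ`. -/
def planar (Φ : ℝ →ᵇ ℝ) (P : Cb d → Cb d) (c : ℝ) (ξ : Space d) : ℕ → Cb d
  | 0 => pull Φ (linearFn ξ)
  | n + 1 => pull Φ (linearFn ξ) ⊔ translate (-(c • ξ)) (P (planar Φ P c ξ n))

/-- The analogue of `planar` for a spherical front that starts from radius `L` and expands with
speed `c`, in the resting frame; the factor `cutoff T` makes its support bounded and its
supremum less than `θ`. -/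
def radial (Φ : ℝ →ᵇ ℝ) (P : Cb d → Cb d) (c : ℝ) (T : ℕ) (L : ℝ) : ℕ → Cb d
  | 0 => pull Φ (radialFn L)
  | n + 1 => pull Φ (radialFn (L + (n + 1) * c)) ⊔
      pull (cutoff T) (radialFn (L + (n + 1) * c)) * P (radial Φ P c T L n)

section Fronts

variable {θ l c : ℝ} {P : Cb d → Cb d} {Φ : ℝ →ᵇ ℝ} {ξ : Space d}

lemma planar_succ_apply (Φ : ℝ →ᵇ ℝ) (P : Cb d → Cb d) (c : ℝ) (ξ : Space d) (n : ℕ)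
    (x : Space d) : planar Φ P c ξ (n + 1) x =
      max (Φ (inner ℝ x ξ)) (P (planar Φ P c ξ n) (x + c • ξ)) := by
  change max _ (P (planar Φ P c ξ n) (x - -(c • ξ))) = _
  rw [sub_neg_eq_add]
  rfl

lemma radial_succ_apply (Φ : ℝ →ᵇ ℝ) (P : Cb d → Cb d) (c : ℝ) (T : ℕ) (L : ℝ) (n : ℕ)
    (x : Space d) : radial Φ P c T L (n + 1) x =
      max (Φ (‖x‖ - (L + (n + 1) * c)))
        (cutoff T (‖x‖ - (L + (n + 1) * c)) * P (radial Φ P c T L n) x) := rfl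

lemma IsFrontProfile.nonneg (hΦ : IsFrontProfile Φ l θ) (s : ℝ) : 0 ≤ Φ s := by
  rw [← hΦ.eq_zero _ (le_max_right s 0)]
  exact hΦ.antitone (le_max_left _ _)

lemma IsFrontProfile.le_top (hΦ : IsFrontProfile Φ l θ) (s : ℝ) : Φ s ≤ θ :=
  (hΦ.le s).trans hΦ.lt.le

lemma IsMonotoneEvolution.planar_mem (hP : IsMonotoneEvolution E θ P)
    (hΦ : IsFrontProfile Φ l θ) (c : ℝ) (ξ : Space d) (n : ℕ) :
    planar Φ P c ξ n ∈ tube E θ := by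
  induction n with
  | zero => exact ⟨pull_linearFn_mem hP.phase hΦ.uniformContinuous ξ,
      fun x => ⟨hΦ.nonneg _, hΦ.le_top _⟩⟩
  | succ n ih =>
    have hm := translate_mem_tube hP.phase (hP.mem _ ih) (-(c • ξ))
    exact ⟨sup_mem hP.phase (pull_linearFn_mem hP.phase hΦ.uniformContinuous ξ) hm.1,
      fun x => ⟨le_max_of_le_left (hΦ.nonneg _), max_le (hΦ.le_top _) (hm.2 x).2⟩⟩

lemma IsMonotoneEvolution.planar_le_succ (hP : IsMonotoneEvolution E θ P)
    (hΦ : IsFrontProfile Φ l θ) (c : ℝ) (ξ : Space d) (n : ℕ) (x : Space d) :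
    planar Φ P c ξ n x ≤ planar Φ P c ξ (n + 1) x := by
  induction n generalizing x with
  | zero => exact le_max_left _ _
  | succ n ih =>
    rw [planar_succ_apply, planar_succ_apply _ _ _ _ (n + 1)]
    exact max_le_max le_rfl (hP.mono _ (hP.planar_mem hΦ c ξ n) _ (hP.planar_mem hΦ c ξ (n + 1))
      ih _)

/-- Pointwise convergence of the increasing planar iterates is locally uniform. -/
lemma IsMonotoneEvolution.planar_locConv (hP : IsMonotoneEvolution E θ P)
    (hΦ : IsFrontProfile Φ l θ)
    (h : ∀ x, Tendsto (fun n => planar Φ P c ξ n x) atTop (𝓝 θ)) :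
    LocConv (planar Φ P c ξ) (constFun d θ) := by
  rw [locConv_iff_tendstoLocallyUniformly]
  refine Monotone.tendstoLocallyUniformly_of_forall_tendsto (fun n => (planar Φ P c ξ n).continuous)
    (monotone_nat_of_le_succ fun n => hP.planar_le_succ hΦ c ξ n) (constFun d θ).continuous h

lemma IsMonotoneEvolution.radial_mem (hP : IsMonotoneEvolution E θ P)
    (hΦ : IsFrontProfile Φ l θ) (c : ℝ) (T : ℕ) (L : ℝ) (n : ℕ) :
    radial Φ P c T L n ∈ tube E θ := by
  induction n with
  | zero => exact ⟨pull_radialFn_mem hP.phase hΦ.uniformContinuous _,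
      fun x => ⟨hΦ.nonneg _, hΦ.le_top _⟩⟩
  | succ n ih =>
    have hm := hP.mem _ ih
    exact ⟨sup_mem hP.phase (pull_radialFn_mem hP.phase hΦ.uniformContinuous _)
        (mul_mem' hP.phase (pull_radialFn_mem hP.phase (cutoff_uniformContinuous T) _) hm.1),
      fun x => ⟨le_max_of_le_left (hΦ.nonneg _), max_le (hΦ.le_top _)
        ((mul_le_of_le_one_left (hm.2 x).1 (cutoff_le_one _ _)).trans (hm.2 x).2)⟩⟩

lemma radial_ge (Φ : ℝ →ᵇ ℝ) (P : Cb d → Cb d) (c : ℝ) (T : ℕ) (L : ℝ) (n : ℕ)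
    (x : Space d) : Φ (‖x‖ - (L + n * c)) ≤ radial Φ P c T L n x := by
  cases n with
  | zero => simp [radial]
  | succ n =>
    rw [radial_succ_apply]
    push_cast
    exact le_max_left _ _

lemma IsMonotoneEvolution.radial_le (hP : IsMonotoneEvolution E θ P)
    (hΦ : IsFrontProfile Φ l θ) (c : ℝ) (T : ℕ) (L : ℝ) (n : ℕ) (x : Space d) :
    radial Φ P c T L n x ≤ max l ((1 - 1 / ((T : ℝ) + 2)) * θ) := by
  cases n with
  | zero => exact le_max_of_le_left (hΦ.le _)
  | succ n =>
    have hm := (hP.mem _ (hP.radial_mem hΦ c T L n)).2 x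
    exact max_le_max (hΦ.le _) (mul_le_mul (cutoff_le _ _) hm.2 hm.1 (cutoff_factor_nonneg T))

lemma IsFrontProfile.radial_eq_zero (hΦ : IsFrontProfile Φ l θ) (P : Cb d → Cb d) (c : ℝ)
    (T : ℕ) (L : ℝ) (n : ℕ) {x : Space d} (hx : L + n * c + T ≤ ‖x‖) :
    radial Φ P c T L n x = 0 := by
  have hT : (0 : ℝ) ≤ T := T.cast_nonneg
  cases n with
  | zero =>
    refine hΦ.eq_zero _ ?_
    simp only [Nat.cast_zero, zero_mul, add_zero] at hx
    rw [radialFn_apply]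
    linarith
  | succ n =>
    push_cast at hx
    rw [radial_succ_apply, hΦ.eq_zero _ (by linarith), cutoff_eq_zero (by linarith), zero_mul,
      max_self]

/-- Starting later from a larger sphere gives less. -/
lemma IsMonotoneEvolution.radial_shift_le (hP : IsMonotoneEvolution E θ P)
    (hΦ : IsFrontProfile Φ l θ) (c : ℝ) (T : ℕ) (L : ℝ) (n : ℕ) (x : Space d) :
    radial Φ P c T (L + c) n x ≤ radial Φ P c T L (n + 1) x := by
  induction n generalizing x with
  | zero =>
    refine le_trans (le_of_eq ?_) (le_max_left _ _)
    simp [radial]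
  | succ n ih =>
    rw [radial_succ_apply, radial_succ_apply _ _ _ _ _ (n + 1)]
    have h1 : L + c + ((n : ℝ) + 1) * c = L + ((n + 1 : ℕ) + 1) * c := by push_cast; ring
    rw [h1]
    refine max_le_max le_rfl (mul_le_mul_of_nonneg_left ?_ (cutoff_nonneg _ _))
    exact hP.mono _ (hP.radial_mem hΦ _ _ _ _) _ (hP.radial_mem hΦ _ _ _ _) ih x

lemma IsMonotoneEvolution.radial_shift_nat_le (hP : IsMonotoneEvolution E θ P)
    (hΦ : IsFrontProfile Φ l θ) (c : ℝ) (T : ℕ) (L : ℝ) (n k : ℕ) (x : Space d) :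
    radial Φ P c T (L + k * c) n x ≤ radial Φ P c T L (n + k) x := by
  induction k generalizing L with
  | zero => simp
  | succ k ih =>
    have h1 : L + ((k + 1 : ℕ) : ℝ) * c = L + c + k * c := by push_cast; ring
    rw [h1]
    exact (ih (L + c)).trans (hP.radial_shift_le hΦ c T L (n + k) x)

/-- A front that starts from a sphere dominates those that start from spheres inside it. -/
lemma IsMonotoneEvolution.translate_radial_le (hP : IsMonotoneEvolution E θ P)
    (hΦ : IsFrontProfile Φ l θ) (c : ℝ) (T : ℕ) {L L' : ℝ} {z : Space d} (h : ‖z‖ + L' ≤ L)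
    (n : ℕ) (x : Space d) :
    translate z (radial Φ P c T L' n) x ≤ radial Φ P c T L n x := by
  have hx : ∀ x : Space d, ∀ s, ‖x‖ - (L + s) ≤ ‖x - z‖ - (L' + s) := fun x s => by
    have := norm_sub_norm_le x z
    linarith
  induction n generalizing x with
  | zero =>
    refine hΦ.antitone ?_
    simpa using hx x 0
  | succ n ih =>
    rw [translate_apply, radial_succ_apply, radial_succ_apply]
    have hm := hP.radial_mem hΦ c T L' n
    refine max_le_max (hΦ.antitone (hx x _)) (mul_le_mul (cutoff_antitone T (hx x _)) ?_
      ((hP.mem _ hm).2 _).1 (cutoff_nonneg _ _))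
    have := hP.mono _ (translate_mem_tube hP.phase hm z) _ (hP.radial_mem hΦ c T L n) ih x
    rwa [hP.transl z _ hm] at this

lemma norm_add_smul_sub_bounds {x ξ : Space d} (hξ : ‖ξ‖ = 1) {M : ℝ} (hM : 0 < M) :
    inner ℝ x ξ ≤ ‖x + M • ξ‖ - M ∧
      ‖x + M • ξ‖ - M ≤ inner ℝ x ξ + ‖x‖ ^ 2 / (2 * M) := by
  have h1 : inner ℝ (x + M • ξ) ξ = inner ℝ x ξ + M := by
    rw [inner_add_left, inner_smul_left, real_inner_self_eq_norm_sq, hξ]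
    simp
  have h2 := real_inner_le_norm (x + M • ξ) ξ
  rw [h1, hξ, mul_one] at h2
  refine ⟨by linarith, ?_⟩
  have h3 := abs_le.1 (abs_real_inner_le_norm x ξ)
  rw [hξ, mul_one] at h3
  set b := inner ℝ x ξ
  set e := ‖x‖ ^ 2 / (2 * M) with he
  have he2 : 2 * M * e = ‖x‖ ^ 2 := by rw [he]; field_simp
  have hnn : 0 ≤ M + b + e := by
    have : 0 ≤ 2 * M * (M - ‖x‖ + e) := by nlinarith [sq_nonneg (M - ‖x‖), sq_nonneg M]
    have := nonneg_of_mul_nonneg_right this (by positivity)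
    linarith [h3.1]
  have hsq : ‖x + M • ξ‖ ^ 2 ≤ (M + b + e) ^ 2 := by
    rw [norm_add_sq_real, inner_smul_right, norm_smul, hξ, Real.norm_eq_abs, abs_of_pos hM]
    change ‖x‖ ^ 2 + 2 * (M * b) + (M * 1) ^ 2 ≤ _
    nlinarith [sq_nonneg (b + e)]
  linarith [le_of_abs_le (abs_le_of_sq_le_sq hsq hnn)]

/-- Large spheres are locally close to their tangent planes. -/
lemma tendsto_norm_add_smul_sub {ι : Type*} {F : Filter ι} {M : ι → ℝ} {x η : ι → Space d}
    {x₀ : Space d} (hM : Tendsto M F atTop) (hx : Tendsto x F (𝓝 x₀))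
    (hη : Tendsto η F (𝓝 ξ)) (hη1 : ∀ i, ‖η i‖ = 1) :
    Tendsto (fun i => ‖x i + M i • η i‖ - M i) F (𝓝 (inner ℝ x₀ ξ)) := by
  have h1 : Tendsto (fun i => inner ℝ (x i) (η i)) F (𝓝 (inner ℝ x₀ ξ)) := hx.inner hη
  have h2 : Tendsto (fun i => inner ℝ (x i) (η i) + ‖x i‖ ^ 2 / (2 * M i)) F
      (𝓝 (inner ℝ x₀ ξ + 0)) :=
    h1.add ((hx.norm.pow 2).div_atTop (hM.const_mul_atTop two_pos))
  rw [add_zero] at h2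
  refine tendsto_of_tendsto_of_tendsto_of_le_of_le' h1 h2 ?_ ?_
  · filter_upwards [hM.eventually_gt_atTop 0] with i hi
      using (norm_add_smul_sub_bounds (hη1 i) hi).1
  · filter_upwards [hM.eventually_gt_atTop 0] with i hi
      using (norm_add_smul_sub_bounds (hη1 i) hi).2

/-- Near its boundary, a large spherical front looks like a planar front. -/
lemma IsMonotoneEvolution.radial_locConv (hP : IsMonotoneEvolution E θ P)
    (hΦ : IsFrontProfile Φ l θ) {T : ℕ → ℕ} {L : ℕ → ℝ} {η : ℕ → Space d}
    (hT : Tendsto T atTop atTop) (hL : Tendsto L atTop atTop) (hη : Tendsto η atTop (𝓝 ξ))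
    (hη1 : ∀ j, ‖η j‖ = 1) (n : ℕ) :
    LocConv (fun j => translate (-((L j + n * c) • η j)) (radial Φ P c (T j) (L j) n))
      (planar Φ P c ξ n) := by
  have hdist : ∀ s x, Tendsto (fun q : ℕ × Space d =>
      ‖q.2 + (L q.1 + s) • η q.1‖ - (L q.1 + s)) (atTop ×ˢ 𝓝 x) (𝓝 (inner ℝ x ξ)) := fun s x =>
    tendsto_norm_add_smul_sub ((tendsto_atTop_add_const_right _ s hL).comp tendsto_fst)
      tendsto_snd (hη.comp tendsto_fst) fun _ => hη1 _
  induction n with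
  | zero =>
    intro x
    have := (Φ.continuous.tendsto _).comp (hdist 0 x)
    simpa [radial, planar, Function.comp_def] using this
  | succ n ih =>
    have hmem : ∀ j, radial Φ P c (T j) (L j) n ∈ tube E θ := fun j => hP.radial_mem hΦ _ _ _ _
    have h1 := (hP.cont _ _ (fun j => translate_mem_tube hP.phase (hmem j) _)
      (hP.planar_mem hΦ c ξ n) ih).translate ((hη.const_smul c).neg)
    intro x
    have h2 := h1 x
    simp only [hP.transl _ _ (hmem _), translate_apply, sub_neg_eq_add] at h2
    simp only [translate_apply, sub_neg_eq_add, radial_succ_apply, planar_succ_apply]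
    push_cast
    have h3 : ∀ q : ℕ × Space d, q.2 + c • η q.1 + (L q.1 + n * c) • η q.1 =
        q.2 + (L q.1 + (n + 1) * c) • η q.1 := fun q => by module
    simp only [h3] at h2
    refine ((Φ.continuous.tendsto _).comp (hdist _ x)).max ?_
    simpa using (tendsto_cutoff (hT.comp tendsto_fst) (hdist ((n + 1) * c) x)).mul h2

/-- If the planar iterates converge to `θ` in all directions, then some iterate of a spherical
front exceeds, after one more step, the supremum `l` of the profile all over the next sphere. -/
lemma IsMonotoneEvolution.exists_lt_radial (hP : IsMonotoneEvolution E θ P)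
    (hΦ : IsFrontProfile Φ l θ) (hc : 0 < c)
    (hpl : ∀ ξ : Space d, ‖ξ‖ = 1 → ∀ x, Tendsto (fun n => planar Φ P c ξ n x) atTop (𝓝 θ)) :
    ∃ (N T : ℕ) (L : ℝ), 0 ≤ L ∧
      ∀ ξ : Space d, ‖ξ‖ = 1 → l < P (radial Φ P c T L N) ((L + (N + 1) * c) • ξ) := by
  by_contra! hcon
  choose η hη1 hη using fun n : ℕ => hcon n n n n.cast_nonneg
  obtain ⟨ξ, hξ, ψ, hψ, hlim⟩ := (isCompact_sphere (0 : Space d) 1).tendsto_subseq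
    (x := η) fun n => by simp [hη1 n]
  have hξ1 : ‖ξ‖ = 1 := by simpa using hξ
  have hθ := const_mem_tube hP.phase hP.top_pos.le (le_refl θ)
  have hN := (hP.cont _ _ (hP.planar_mem hΦ c ξ) hθ
    (hP.planar_locConv hΦ (hpl ξ hξ1))).tendsto_apply (c • ξ)
  rw [hP.map_top, constFun_apply] at hN
  obtain ⟨N, hN⟩ := (hN.eventually (lt_mem_nhds hΦ.lt)).exists
  have hψ' := hψ.tendsto_atTop
  have hψr : Tendsto (fun n => (ψ n : ℝ)) atTop atTop := tendsto_natCast_atTop_atTop.comp hψ'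
  have hL : Tendsto (fun n => (ψ n : ℝ) + ((ψ n : ℝ) - N) * c) atTop atTop :=
    hψr.atTop_add_atTop ((tendsto_atTop_add_const_right _ (-(N : ℝ)) hψr).atTop_mul_const hc)
  have hconv := (hP.radial_locConv (c := c) hΦ hψ' hL hlim (fun n => hη1 (ψ n)) N)
  have hmem : ∀ n, radial Φ P c (ψ n) ((ψ n : ℝ) + ((ψ n : ℝ) - N) * c) N ∈ tube E θ :=
    fun n => hP.radial_mem hΦ _ _ _ _
  have h1 := ((hP.cont _ _ (fun j => translate_mem_tube hP.phase (hmem j) _)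
      (hP.planar_mem hΦ c ξ N) hconv).translate ((hlim.const_smul c).neg)).tendsto_apply 0
  simp only [hP.transl _ _ (hmem _), translate_apply, sub_neg_eq_add, zero_add] at h1
  obtain ⟨n, hn1, hn2⟩ := ((h1.eventually (lt_mem_nhds hN)).and
    (hψ'.eventually_ge_atTop N)).exists
  obtain ⟨k, hk⟩ := Nat.exists_eq_add_of_le hn2
  refine absurd (hη (ψ n)) (not_le.2 (hn1.trans_le ?_))
  have hkr : ((ψ n : ℝ) - N) = k := by rw [hk]; push_cast; ring
  have h2 : c • (η ∘ ψ) n + ((ψ n : ℝ) + ((ψ n : ℝ) - N) * c + N * c) • (η ∘ ψ) n =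
      ((ψ n : ℝ) + ((ψ n : ℝ) + 1) * c) • η (ψ n) := by
    simp only [Function.comp]
    module
  rw [h2, hkr]
  refine hP.mono _ (hP.radial_mem hΦ _ _ _ _) _ (hP.radial_mem hΦ _ _ _ _) (fun x => ?_) _
  have h3 := hP.radial_shift_nat_le hΦ c (ψ n) (ψ n) N k x
  rwa [← hk] at h3

/-- Large spherical fronts are subsolutions that expand with speed `c`. -/
lemma IsMonotoneEvolution.radial_le_map (hP : IsMonotoneEvolution E θ P)
    (hΦ : IsFrontProfile Φ l θ) (hd : 1 ≤ d) (hc : 0 < c) {N T : ℕ} {L₀ : ℝ}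
    (hgood : ∀ ξ : Space d, ‖ξ‖ = 1 → l < P (radial Φ P c T L₀ N) ((L₀ + (N + 1) * c) • ξ))
    {L : ℝ} (hL : 2 * L₀ + (N + 1) * c ≤ L) (x : Space d) :
    radial Φ P c T (L + c) N x ≤ P (radial Φ P c T L N) x := by
  have hmem : ∀ L, radial Φ P c T L N ∈ tube E θ := fun L => hP.radial_mem hΦ _ _ _ _
  have hPmem := (hP.mem _ (hmem L)).2 x
  refine (hP.radial_shift_le hΦ c T L N x).trans ?_
  rw [radial_succ_apply]
  refine max_le ?_ (mul_le_of_le_one_left hPmem.1 (cutoff_le_one _ _))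
  rcases le_total (L + (N + 1) * c) ‖x‖ with hx | hx
  · rw [hΦ.eq_zero _ (by linarith)]
    exact hPmem.1
  · obtain ⟨ξ, hξ, hxξ⟩ : ∃ ξ : Space d, ‖ξ‖ = 1 ∧ x = ‖x‖ • ξ := by
      rcases eq_or_ne x 0 with rfl | h0
      · have : Nonempty (Fin d) := ⟨⟨0, hd⟩⟩
        obtain ⟨ξ, hξ⟩ := exists_norm_eq (Space d) zero_le_one
        exact ⟨ξ, hξ, by simp⟩
      · refine ⟨‖x‖⁻¹ • x, norm_smul_inv_norm h0, ?_⟩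
        rw [smul_smul, mul_inv_cancel₀ (norm_ne_zero_iff.2 h0), one_smul]
    -- a translate of the sphere of radius `L₀` inside the sphere of radius `L`
    set z : Space d := (‖x‖ - (L₀ + (N + 1) * c)) • ξ with hz
    have hNc : 0 ≤ ((N : ℝ) + 1) * c := by positivity
    have hzn : ‖z‖ + L₀ ≤ L := by
      rw [hz, norm_smul, hξ, mul_one, Real.norm_eq_abs]
      have : |‖x‖ - (L₀ + (N + 1) * c)| ≤ L - L₀ :=
        abs_le.2 ⟨by linarith [norm_nonneg x], by linarith⟩
      linarith
    have h1 := hP.mono _ (translate_mem_tube hP.phase (hmem L₀) z) _ (hmem L)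
      (hP.translate_radial_le hΦ c T hzn N) x
    rw [hP.transl z _ (hmem L₀), translate_apply] at h1
    have h2 : x - z = (L₀ + (N + 1) * c) • ξ := by
      rw [hz]
      nth_rewrite 1 [hxξ]
      module
    rw [h2] at h1
    exact (hΦ.le _).trans ((hgood ξ hξ).le.trans h1)

lemma IsMonotoneEvolution.radial_le_iterate (hP : IsMonotoneEvolution E θ P)
    (hΦ : IsFrontProfile Φ l θ) (hc : 0 < c) {N T : ℕ} {L₁ : ℝ}
    (hstep : ∀ L, L₁ ≤ L → ∀ x, radial Φ P c T (L + c) N x ≤ P (radial Φ P c T L N) x)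
    (n : ℕ) (x : Space d) :
    radial Φ P c T (L₁ + n * c) N x ≤ P^[n] (radial Φ P c T L₁ N) x := by
  induction n generalizing x with
  | zero => simp
  | succ n ih =>
    have h1 : L₁ + ((n + 1 : ℕ) : ℝ) * c = L₁ + n * c + c := by push_cast; ring
    rw [h1, Function.iterate_succ_apply']
    refine (hstep _ (le_add_of_nonneg_right (by positivity)) x).trans ?_
    exact hP.mono _ (hP.radial_mem hΦ _ _ _ _) _
      ((hP.iterate n).mem _ (hP.radial_mem hΦ _ _ _ _)) ih x

/-- If the planar iterates with speed `c > 0` converge to `θ` in all directions and positive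
constants are driven to `θ`, then every state that is at least `σ` on a large ball spreads in all
directions with any speed `c' < c`. -/
theorem IsMonotoneEvolution.exists_spreading_radius (hP : IsMonotoneEvolution E θ P)
    (hΦ : IsFrontProfile Φ l θ) (hd : 1 ≤ d) (hc : 0 < c)
    (hpl : ∀ ξ : Space d, ‖ξ‖ = 1 → ∀ x, Tendsto (fun n => planar Φ P c ξ n x) atTop (𝓝 θ))
    (hconst : ∀ r, 0 < r → r < θ → Tendsto (fun n => P^[n] (constFun d r) 0) atTop (𝓝 θ))
    {c' σ : ℝ} (hc' : c' < c) (hσ : 0 < σ) (hσθ : σ < θ) :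
    ∃ r > 0, ∀ v ∈ tube E θ, ∀ x₀, (∀ x ∈ Metric.ball x₀ r, σ ≤ v x) → ∀ ε > 0,
      ∀ᶠ n : ℕ in atTop, ∀ x, ‖x‖ ≤ n * c' → θ - ε ≤ P^[n] v x := by
  have hθ := hP.top_pos
  obtain ⟨N, T, L₀, hL₀, hgood⟩ := hP.exists_lt_radial hΦ hc hpl
  set L₁ := 2 * L₀ + (N + 1) * c with hL₁
  have hL₁0 : 0 < L₁ := by positivity
  have hiter := hP.radial_le_iterate hΦ hc
    (fun L hL => hP.radial_le_map hΦ hd hc hgood (L := L) hL)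
  have hWmem : ∀ L, radial Φ P c T L N ∈ tube E θ := fun L => hP.radial_mem hΦ _ _ _ _
  -- the supremum of the spherical front is less than `θ`
  set τ := max l ((1 - 1 / ((T : ℝ) + 2)) * θ)
  have hτ : τ < θ := max_lt hΦ.lt (mul_lt_of_lt_one_left hθ (sub_lt_self _ (by positivity)))
  obtain ⟨k, hk⟩ := ((hconst σ hσ hσθ).eventually (lt_mem_nhds hτ)).exists
  obtain ⟨R, hR, δ, hδ, hRδ⟩ := (hP.iterate k).exists_radius hσ hσθ.le hk
  set S := L₁ + N * c + T
  have hS : 0 < S := by positivity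
  refine ⟨S + R, by positivity, fun v hv x₀ hx₀ ε hε => ?_⟩
  have hstart : ∀ x, translate x₀ (radial Φ P c T L₁ N) x ≤ P^[k] v x := fun x => by
    rw [translate_apply]
    rcases le_total S ‖x - x₀‖ with hx | hx
    · rw [hΦ.radial_eq_zero P c T L₁ N hx]
      exact (((hP.iterate k).mem v hv).2 x).1
    · refine (hP.radial_le hΦ c T L₁ N _).trans (hRδ v hv x fun y hy => ?_)
      refine (sub_le_self _ hδ.le).trans (hx₀ y ?_)
      rw [Metric.mem_ball, dist_eq_norm] at hy ⊢
      calc ‖y - x₀‖ = ‖(x - x₀) + (y - x)‖ := by congr 1; abel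
        _ ≤ ‖x - x₀‖ + ‖y - x‖ := norm_add_le _ _
        _ < S + R := by linarith
  obtain ⟨s₀, hs₀⟩ := hΦ.exists_pos
  have hs₀θ : Φ s₀ < θ := (hΦ.le _).trans_lt hΦ.lt
  -- after `n` further steps the state is at least `Φ s₀` on a ball of radius about `n c`
  have hball : ∀ (n : ℕ) (x : Space d), ‖x‖ + ‖x₀‖ ≤ n * c + s₀ → Φ s₀ ≤ P^[n + k] v x := by
    intro n x hx
    have h1 := (hP.iterate n).mono _ (translate_mem_tube hP.phase (hWmem L₁) x₀) _
      ((hP.iterate k).mem v hv) hstart x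
    rw [(hP.iterate n).transl x₀ _ (hWmem L₁), translate_apply, ← Function.iterate_add_apply] at h1
    refine le_trans ?_ ((hiter n (x - x₀)).trans h1)
    refine (hΦ.antitone ?_).trans (radial_ge Φ P c T _ N _)
    have := norm_sub_le x x₀
    have hN : 0 ≤ (N : ℝ) * c := by positivity
    linarith
  obtain ⟨k', hk'⟩ := ((hconst _ hs₀ hs₀θ).eventually
    (lt_mem_nhds (show θ - ε < θ by linarith))).exists
  obtain ⟨R', hR', δ', hδ', hRδ'⟩ := (hP.iterate k').exists_radius hs₀ hs₀θ.le hk'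
  have hev : ∀ᶠ n : ℕ in atTop, R' + ‖x₀‖ + (k' + k) * c - s₀ ≤ (n : ℝ) * (c - c') :=
    (tendsto_natCast_atTop_atTop.atTop_mul_const (sub_pos.2 hc')).eventually_ge_atTop _
  filter_upwards [hev, eventually_ge_atTop (k' + k)] with n hn hnk x hx
  obtain ⟨j, rfl⟩ := Nat.exists_eq_add_of_le hnk
  have hj : k' + k + j = k' + (j + k) := by ring
  rw [hj, Function.iterate_add_apply]
  refine hRδ' _ ((hP.iterate _).mem v hv) x fun y hy => (sub_le_self _ hδ'.le).trans
    (hball j y ?_)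
  rw [Metric.mem_ball, dist_eq_norm] at hy
  have h2 : ‖y‖ ≤ ‖x‖ + ‖y - x‖ := by
    simpa using norm_add_le x (y - x)
  push_cast at hn hx
  nlinarith

end Fronts

/-! ### Planar iterates and the spreading speeds -/

lemma exists_isFrontProfile {θ : ℝ} {φ : ℝ → ℝ} (hφ : φ ∈ profiles θ) :
    ∃ (Φ : ℝ →ᵇ ℝ) (l : ℝ), IsFrontProfile Φ l θ ∧ ⇑Φ = φ := by
  obtain ⟨hc, ha, h0, l, hl0, hlθ, hl⟩ := hφ
  have hle : ∀ s, φ s ≤ l := fun s => ha.ge_of_tendsto hl s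
  have hnn : ∀ s, 0 ≤ φ s := fun s => by
    rw [← h0 _ (le_max_right s 0)]
    exact ha (le_max_left _ _)
  refine ⟨BoundedContinuousFunction.ofNormedAddCommGroup φ hc l fun s => by
    rw [Real.norm_eq_abs, abs_of_nonneg (hnn s)]; exact hle s, l,
    ⟨?_, ha, h0, hle, hlθ, (hl.eventually (lt_mem_nhds hl0)).exists⟩, rfl⟩
  -- subtracting a Lipschitz function with the same limits leaves a function that vanishes at `±∞`
  have hcl : UniformContinuous fun s : ℝ => l * max 0 (min 1 (-s)) := by
    have h1 : LipschitzWith 1 fun s : ℝ => -s := LipschitzWith.id.neg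
    exact (uniformContinuous_const_smul l).comp ((h1.const_min 1).const_max 0).uniformContinuous
  have hdiff : UniformContinuous fun s => φ s - l * max 0 (min 1 (-s)) := by
    refine Continuous.uniformContinuous_of_tendsto_cocompact (x := 0)
      (hc.sub hcl.continuous) ?_
    rw [cocompact_eq_atBot_atTop, tendsto_sup]
    constructor
    · have h1 : Tendsto (fun s => φ s - l) atBot (𝓝 0) := by simpa using hl.sub_const l
      refine h1.congr' ?_
      filter_upwards [eventually_le_atBot (-1)] with s hs
      rw [min_eq_left (by linarith), max_eq_right zero_le_one, mul_one]
    · refine tendsto_const_nhds.congr' ?_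
      filter_upwards [eventually_ge_atTop 0] with s hs
      rw [h0 s hs, max_eq_left ((min_le_right _ _).trans (by linarith)), mul_zero, sub_zero]
  have := hdiff.add hcl
  simpa using this

section Planar

variable {θ l c : ℝ} {P : Cb d → Cb d} {Φ : ℝ →ᵇ ℝ} {ξ : Space d}

/-- The planar iterates are constant orthogonally to the direction `ξ` of propagation. -/
lemma IsMonotoneEvolution.translate_planar (hP : IsMonotoneEvolution E θ P)
    (hΦ : IsFrontProfile Φ l θ) (c : ℝ) {y : Space d} (hy : inner ℝ y ξ = 0) (n : ℕ) :
    translate y (planar Φ P c ξ n) = planar Φ P c ξ n := by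
  have hinner : ∀ x, inner ℝ (x - y) ξ = inner ℝ x ξ := fun x => by
    rw [inner_sub_left, hy, sub_zero]
  induction n with
  | zero =>
    ext x
    simp [planar, hinner]
  | succ n ih =>
    ext x
    have h1 := hP.transl y _ (hP.planar_mem hΦ c ξ n)
    rw [ih] at h1
    have h2 := DFunLike.congr_fun h1 (x + c • ξ)
    rw [translate_apply] at h2
    rw [translate_apply, planar_succ_apply, planar_succ_apply, hinner, h2, sub_add_eq_add_sub]

lemma IsMonotoneEvolution.planar_add_smul_le (hP : IsMonotoneEvolution E θ P)
    (hΦ : IsFrontProfile Φ l θ) (c : ℝ) (hξ : ‖ξ‖ = 1) {s : ℝ} (hs : 0 ≤ s) (n : ℕ)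
    (x : Space d) : planar Φ P c ξ n (x + s • ξ) ≤ planar Φ P c ξ n x := by
  have hinner : ∀ x, inner ℝ x ξ ≤ inner ℝ (x + s • ξ) ξ := fun x => by
    rw [inner_add_left, inner_smul_left, real_inner_self_eq_norm_sq, hξ]
    simpa using hs
  induction n generalizing x with
  | zero => exact hΦ.antitone (hinner x)
  | succ n ih =>
    have hm := hP.planar_mem hΦ c ξ n
    rw [planar_succ_apply, planar_succ_apply]
    refine max_le_max (hΦ.antitone (hinner x)) ?_
    have h1 := hP.mono _ (translate_mem_tube hP.phase hm (-(s • ξ))) _ hm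
      (fun y => by rw [translate_apply, sub_neg_eq_add]; exact ih y) (x + c • ξ)
    rw [hP.transl _ _ hm, translate_apply, sub_neg_eq_add] at h1
    rwa [add_right_comm]

lemma IsMonotoneEvolution.map_planar_add_smul_le (hP : IsMonotoneEvolution E θ P)
    (hΦ : IsFrontProfile Φ l θ) (c : ℝ) (hξ : ‖ξ‖ = 1) {s : ℝ} (hs : 0 ≤ s) (n : ℕ)
    (x : Space d) : P (planar Φ P c ξ n) (x + s • ξ) ≤ P (planar Φ P c ξ n) x := by
  have hm := hP.planar_mem hΦ c ξ n
  have h1 := hP.mono _ (translate_mem_tube hP.phase hm (-(s • ξ))) _ hm (fun y => by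
    rw [translate_apply, sub_neg_eq_add]
    exact hP.planar_add_smul_le hΦ c hξ hs n y) x
  rwa [hP.transl _ _ hm, translate_apply, sub_neg_eq_add] at h1

lemma IsMonotoneEvolution.planar_antitone_speed (hP : IsMonotoneEvolution E θ P)
    (hΦ : IsFrontProfile Φ l θ) (hξ : ‖ξ‖ = 1) {c c' : ℝ} (hc : c ≤ c') (n : ℕ) (x : Space d) :
    planar Φ P c' ξ n x ≤ planar Φ P c ξ n x := by
  induction n generalizing x with
  | zero => exact le_rfl
  | succ n ih =>
    rw [planar_succ_apply, planar_succ_apply]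
    refine max_le_max le_rfl ((hP.mono _ (hP.planar_mem hΦ c' ξ n) _ (hP.planar_mem hΦ c ξ n)
      ih _).trans ?_)
    have := hP.map_planar_add_smul_le hΦ c hξ (sub_nonneg.2 hc) n (x + c • ξ)
    rwa [add_assoc, ← add_smul, add_sub_cancel] at this

/-- Passing to a moving frame changes the speed in the direction `ξ` by `p · ξ`. -/
lemma IsMonotoneEvolution.planar_translate_comp (hP : IsMonotoneEvolution E θ P)
    (hΦ : IsFrontProfile Φ l θ) (hξ : ‖ξ‖ = 1) (p : Space d) (c : ℝ) (n : ℕ) :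
    planar Φ (fun v => translate (-p) (P v)) c ξ n = planar Φ P (c + inner ℝ p ξ) ξ n := by
  induction n with
  | zero => rfl
  | succ n ih =>
    ext x
    rw [planar_succ_apply, planar_succ_apply, ih, translate_apply]
    set A := planar Φ P (c + inner ℝ p ξ) ξ n
    have hy : inner ℝ (p - (inner ℝ p ξ : ℝ) • ξ) ξ = 0 := by
      rw [inner_sub_left, inner_smul_left, real_inner_self_eq_norm_sq, hξ]
      simp
    have h1 := hP.transl (p - (inner ℝ p ξ : ℝ) • ξ) _
      (hP.planar_mem hΦ (c + inner ℝ p ξ) ξ n)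
    rw [hP.translate_planar hΦ _ hy] at h1
    have h2 := DFunLike.congr_fun h1 (x + c • ξ - -p)
    rw [translate_apply] at h2
    rw [h2]
    congr 2
    module

/-- The one-dimensional iterates in the definition of the spreading speed are the sections of the
planar iterates. -/
lemma IsMonotoneEvolution.iterate_R_eq_planar (hP : IsMonotoneEvolution E θ P)
    (hΦ : IsFrontProfile Φ l θ) {a : Space d → ℝ} {κ m : ℝ} {G : Cb d → Cb d} {t : ℝ}
    (hQ : ∀ v ∈ tube E θ, Q E a κ m θ G t v = P v) (hξ : ‖ξ‖ = 1) (c : ℝ) (n : ℕ)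
    (x : Space d) :
    (R E a κ m θ G Φ t c ξ)^[n] Φ (inner ℝ x ξ) = planar Φ P c ξ n x := by
  induction n generalizing x with
  | zero => rfl
  | succ n ih =>
    have hm := hP.planar_mem hΦ c ξ n
    rw [Function.iterate_succ_apply', R, planar_succ_apply]
    have hV : V (inner ℝ x ξ) c ξ ((R E a κ m θ G Φ t c ξ)^[n] Φ) =
        translate (-(x + c • ξ)) (planar Φ P c ξ n) := by
      funext y
      rw [V, translate_apply, ← ih, sub_neg_eq_add, inner_add_left, inner_add_left,
        inner_smul_left, real_inner_self_eq_norm_sq, hξ]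
      simp [add_assoc]
    rw [hV, hQ _ (translate_mem_tube hP.phase hm _), hP.transl _ _ hm, translate_apply, zero_sub,
      neg_neg]

lemma IsMonotoneEvolution.tendsto_planar_of_lt_cStar (hP : IsMonotoneEvolution E θ P)
    (hΦ : IsFrontProfile Φ l θ) {a : Space d → ℝ} {κ m : ℝ} {G : Cb d → Cb d} {t : ℝ}
    (hQ : ∀ v ∈ tube E θ, Q E a κ m θ G t v = P v) (hξ : ‖ξ‖ = 1) {c : ℝ}
    (hc : (c : EReal) < cStar E a κ m θ G Φ t ξ) (x : Space d) :
    Tendsto (fun n => planar Φ P c ξ n x) atTop (𝓝 θ) := by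
  obtain ⟨_, ⟨c', ⟨f, hf, hfθ⟩, rfl⟩, hcc'⟩ := lt_sSup_iff.1 hc
  have hcc : c ≤ c' := (EReal.coe_lt_coe_iff.1 hcc').le
  have hf' : ∀ x, Tendsto (fun n => planar Φ P c' ξ n x) atTop (𝓝 (f (inner ℝ x ξ))) := fun x =>
    (hf (inner ℝ x ξ)).congr fun n => hP.iterate_R_eq_planar hΦ hQ hξ c' n x
  have hle : ∀ x, f (inner ℝ x ξ) ≤ θ := fun x =>
    le_of_tendsto' (hf' x) fun n => ((hP.planar_mem hΦ c' ξ n).2 x).2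
  -- `f` is non-increasing with the limit `θ` at infinity and at most `θ`, hence equal to `θ`
  have hge : θ ≤ f (inner ℝ x ξ) := by
    refine le_of_tendsto hfθ ?_
    filter_upwards [eventually_ge_atTop (inner ℝ x ξ : ℝ)] with s hs
    have h1 : inner ℝ (x + (s - inner ℝ x ξ) • ξ) ξ = s := by
      rw [inner_add_left, inner_smul_left, real_inner_self_eq_norm_sq, hξ]
      simp
    rw [← h1]
    exact le_of_tendsto_of_tendsto' (hf' _) (hf' x) fun n =>
      hP.planar_add_smul_le hΦ c' hξ (sub_nonneg.2 hs) n x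
  have heq : f (inner ℝ x ξ) = θ := le_antisymm (hle x) hge
  refine tendsto_of_tendsto_of_tendsto_of_le_of_le (heq ▸ hf' x) tendsto_const_nhds
    (fun n => hP.planar_antitone_speed hΦ hξ hcc n x)
    fun n => ((hP.planar_mem hΦ c ξ n).2 x).2

lemma IsMonotoneEvolution.iterate_translate_comp (hP : IsMonotoneEvolution E θ P) (p : Space d)
    {v : Cb d} (hv : v ∈ tube E θ) (n : ℕ) (x : Space d) :
    (fun v => translate (-p) (P v))^[n] v x = P^[n] v (x + (n : ℝ) • p) := by
  have key : (fun v => translate (-p) (P v))^[n] v = translate (-((n : ℝ) • p)) (P^[n] v) := by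
    induction n with
    | zero => ext x; simp
    | succ n ih =>
      rw [Function.iterate_succ_apply', ih, Function.iterate_succ_apply',
        hP.transl _ _ ((hP.iterate n).mem v hv)]
      ext x
      simp only [translate_apply]
      congr 1
      push_cast
      module
  rw [key, translate_apply, sub_neg_eq_add]

/-- Weinberger's theorem on the lower bound for the spreading speeds, for the iterates of a
monotone evolution. -/
theorem IsMonotoneEvolution.exists_radius_of_subset_interior (hP : IsMonotoneEvolution E θ P)
    (hΦ : IsFrontProfile Φ l θ) (hd : 1 ≤ d)
    (hconst : ∀ r, 0 < r → r < θ → Tendsto (fun n => P^[n] (constFun d r) 0) atTop (𝓝 θ))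
    {a : Space d → ℝ} {κ m : ℝ} {G : Cb d → Cb d} {t : ℝ}
    (hQ : ∀ v ∈ tube E θ, Q E a κ m θ G t v = P v) {C : Set (Space d)} (hC : IsCompact C)
    (hCΥ : C ⊆ interior (Upsilon E a κ m θ G Φ t)) {σ : ℝ} (hσ : 0 < σ) (hσθ : σ < θ) :
    ∃ r > 0, ∀ v ∈ tube E θ, ∀ x₀, (∀ x ∈ Metric.ball x₀ r, σ ≤ v x) → ∀ ε > 0,
      ∀ᶠ n : ℕ in atTop, ∀ y ∈ C, θ - ε ≤ P^[n] v ((n : ℝ) • y) := by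
  refine hC.induction_on (p := fun C => ∃ r > 0, ∀ v ∈ tube E θ, ∀ x₀,
    (∀ x ∈ Metric.ball x₀ r, σ ≤ v x) → ∀ ε > 0,
      ∀ᶠ n : ℕ in atTop, ∀ y ∈ C, θ - ε ≤ P^[n] v ((n : ℝ) • y)) ?_ ?_ ?_ ?_
  · exact ⟨1, one_pos, fun v _ x₀ _ ε _ => by simp⟩
  · rintro A B hAB ⟨r, hr, h⟩
    refine ⟨r, hr, fun v hv x₀ hx₀ ε hε => ?_⟩
    filter_upwards [h v hv x₀ hx₀ ε hε] with n hn y hy using hn y (hAB hy)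
  · rintro A B ⟨r, hr, h⟩ ⟨r', hr', h'⟩
    refine ⟨max r r', lt_max_of_lt_left hr, fun v hv x₀ hx₀ ε hε => ?_⟩
    filter_upwards [
      h v hv x₀ (fun x hx => hx₀ x (Metric.ball_subset_ball (le_max_left _ _) hx)) ε hε,
      h' v hv x₀ (fun x hx => hx₀ x (Metric.ball_subset_ball (le_max_right _ _) hx)) ε hε]
      with n hn hn' y hy
    exact hy.elim (hn y) (hn' y)
  · intro p hp
    obtain ⟨ρ, hρ, hball⟩ := Metric.nhds_basis_closedBall.mem_iff.1
      (mem_interior_iff_mem_nhds.1 (hCΥ hp))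
    have hP' := hP.translate_comp (-p)
    -- in the frame moving with `p` all the spreading speeds are at least `ρ`
    have hpl : ∀ ξ : Space d, ‖ξ‖ = 1 → ∀ x,
        Tendsto (fun n => planar Φ (fun v => translate (-p) (P v)) (ρ / 2) ξ n x) atTop
          (𝓝 θ) := by
      intro ξ hξ x
      have hmem : p + ρ • ξ ∈ Upsilon E a κ m θ G Φ t := hball (by
        rw [Metric.mem_closedBall, dist_eq_norm, add_sub_cancel_left, norm_smul, hξ, mul_one,
          Real.norm_eq_abs, abs_of_pos hρ])
      have h1 : inner ℝ (p + ρ • ξ) ξ = inner ℝ p ξ + ρ := by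
        rw [inner_add_left, inner_smul_left, real_inner_self_eq_norm_sq, hξ]
        simp
      have h2 := hmem ξ hξ
      rw [h1] at h2
      simp only [hP.planar_translate_comp hΦ hξ]
      refine hP.tendsto_planar_of_lt_cStar hΦ hQ hξ (lt_of_lt_of_le ?_ h2) x
      exact EReal.coe_lt_coe_iff.2 (by linarith)
    have hconst' : ∀ r, 0 < r → r < θ →
        Tendsto (fun n => (fun v => translate (-p) (P v))^[n] (constFun d r) 0) atTop (𝓝 θ) := by
      intro r h0 h1
      refine (hconst r h0 h1).congr fun n => ?_
      rw [hP.iterate_translate_comp p (const_mem_tube hP.phase h0.le h1.le),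
        (hP.iterate n).map_const h0.le h1.le]
      rfl
    obtain ⟨r, hr, h⟩ := hP'.exists_spreading_radius hΦ hd (half_pos hρ) hpl hconst'
      (show ρ / 4 < ρ / 2 by linarith) hσ hσθ
    refine ⟨Metric.ball p (ρ / 4), mem_nhdsWithin_of_mem_nhds (Metric.ball_mem_nhds p
      (by positivity)), r, hr, fun v hv x₀ hx₀ ε hε => ?_⟩
    filter_upwards [h v hv x₀ hx₀ ε hε] with n hn y hy
    rw [Metric.mem_ball, dist_eq_norm] at hy
    have h1 := hn ((n : ℝ) • (y - p)) (by
      rw [norm_smul, Real.norm_eq_abs, abs_of_nonneg n.cast_nonneg]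
      gcongr)
    rwa [hP.iterate_translate_comp p hv, ← smul_add, sub_add_cancel] at h1

end Planar

/-! ### Continuous time -/

lemma tendsto_sInf_of_le {ι : Type*} {F : Filter ι} {A : ι → Set ℝ} {θ : ℝ}
    (hne : ∀ i, (A i).Nonempty) (hle : ∀ᶠ i in F, ∀ y ∈ A i, y ≤ θ)
    (hge : ∀ ε > 0, ∀ᶠ i in F, ∀ y ∈ A i, θ - ε ≤ y) :
    Tendsto (fun i => sInf (A i)) F (𝓝 θ) := by
  rw [Metric.tendsto_nhds]
  intro ε hε
  filter_upwards [hle, hge (ε / 2) (half_pos hε)] with i h1 h2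
  have h3 : θ - ε / 2 ≤ sInf (A i) := le_csInf (hne i) h2
  obtain ⟨y, hy⟩ := hne i
  have h4 : sInf (A i) ≤ θ := (csInf_le ⟨_, h2⟩ hy).trans (h1 y hy)
  rw [Real.dist_eq, abs_lt]
  constructor <;> linarith

/-- A state close to `θ` on a large ball around `x` stays close to `θ` at `x` for all times in
`[1, 2]`. -/
lemma IsMonotoneReaction.exists_radius_flow {θ q : ℝ} {H : Cb d → Cb d}
    (h : IsMonotoneReaction E θ q H) {ε : ℝ} (hε : 0 < ε) :
    ∃ R > 0, ∃ δ > 0, ∀ s ∈ Icc (1 : ℝ) 2, ∀ v ∈ tube E θ, ∀ x,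
      (∀ y ∈ Metric.ball x R, θ - δ ≤ v y) → θ - ε ≤ flow q H s v x := by
  refine isCompact_Icc.induction_on (p := fun I => ∃ R > 0, ∃ δ > 0, ∀ s ∈ I,
    ∀ v ∈ tube E θ, ∀ x, (∀ y ∈ Metric.ball x R, θ - δ ≤ v y) → θ - ε ≤ flow q H s v x)
    ⟨1, one_pos, 1, one_pos, by simp⟩ ?_ ?_ ?_
  · rintro A B hAB ⟨R, hR, δ, hδ, hB⟩
    exact ⟨R, hR, δ, hδ, fun s hs => hB s (hAB hs)⟩
  · rintro A B ⟨R, hR, δ, hδ, hA⟩ ⟨R', hR', δ', hδ', hB⟩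
    refine ⟨max R R', lt_max_of_lt_left hR, min δ δ', lt_min hδ hδ', fun s hs v hv x hx => ?_⟩
    rcases hs with hs | hs
    · refine hA s hs v hv x fun y hy => ?_
      have := hx y (Metric.ball_subset_ball (le_max_left _ _) hy)
      linarith [min_le_left δ δ']
    · refine hB s hs v hv x fun y hy => ?_
      have := hx y (Metric.ball_subset_ball (le_max_right _ _) hy)
      linarith [min_le_right δ δ']
  · intro s hs
    have hs0 : 0 < s := one_pos.trans_le hs.1
    have hM : 0 < q * θ := mul_pos h.q_pos h.top_pos
    have htop : θ - ε / 2 < flow q H s (constFun d θ) 0 := by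
      rw [h.flow_top hs0.le, constFun_apply]
      linarith
    obtain ⟨R, hR, δ, hδ, hRδ⟩ :=
      (h.flow_isMonotoneEvolution hs0.le).exists_radius h.top_pos le_rfl htop
    refine ⟨Metric.ball s (ε / 2 / (q * θ)) ∩ Ioi 0, mem_nhdsWithin_of_mem_nhds
      (inter_mem (Metric.ball_mem_nhds s (by positivity)) (Ioi_mem_nhds hs0)), R, hR, δ, hδ, ?_⟩
    rintro s' ⟨hs', hs'0⟩ v hv x hx
    have h1 := hRδ v hv x hx
    have h2 := h.norm_flow_sub_le hv hs0 hs'0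
    have h3 := ((flow q H s' v - flow q H s v).norm_coe_le_norm x).trans h2
    rw [Metric.mem_ball, Real.dist_eq, lt_div_iff₀ hM, mul_comm] at hs'
    have h4 := (abs_le.1 h3).1
    simp only [BoundedContinuousFunction.coe_sub, Pi.sub_apply] at h4
    linarith

/-- Convergence to `θ` along integer times on `n C` implies convergence along the ray of any
interior point of `C`, uniformly on compact sets. -/
theorem IsMonotoneReaction.tendsto_flow_along_ray {θ q : ℝ} {H : Cb d → Cb d}
    (h : IsMonotoneReaction E θ q H) {f : Cb d} (hf : f ∈ tube E θ) {C : Set (Space d)}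
    {ν : Space d} (hν : ν ∈ interior C)
    (hn : ∀ ε > 0, ∀ᶠ n : ℕ in atTop, ∀ y ∈ (n : ℝ) • C, θ - ε ≤ flow q H n f y)
    {K : Set (Space d)} (hK : IsCompact K) {ε : ℝ} (hε : 0 < ε) :
    ∀ᶠ t : ℝ in atTop, ∀ x ∈ K, θ - ε ≤ flow q H t f (x + t • ν) := by
  obtain ⟨R, hR, δ, hδ, hRδ⟩ := h.exists_radius_flow hε
  obtain ⟨ρ, hρ, hball⟩ := Metric.mem_nhds_iff.1 (mem_interior_iff_mem_nhds.1 hν)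
  obtain ⟨B, hB⟩ := hK.isBounded.exists_norm_le
  -- time is split as `n + s` with `n` an integer and `s ∈ [1, 2]`
  have hfl : Tendsto (fun t : ℝ => ⌊t⌋₊ - 1) atTop atTop :=
    (tendsto_sub_atTop_nat 1).comp tendsto_nat_floor_atTop
  have hlarge : ∀ᶠ n : ℕ in atTop, R + B + 2 * ‖ν‖ < n * ρ :=
    (tendsto_natCast_atTop_atTop.atTop_mul_const hρ).eventually_gt_atTop _
  filter_upwards [hfl.eventually (hn δ hδ), hfl.eventually hlarge,
    hfl.eventually_ge_atTop 1, eventually_ge_atTop 1] with t h1 h2 h3 ht x hx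
  have hfloor1 : 1 ≤ ⌊t⌋₊ := Nat.le_floor (by simpa using ht)
  set n := ⌊t⌋₊ - 1 with hndef
  have hnf : (⌊t⌋₊ : ℝ) = n + 1 := by
    rw [hndef, Nat.cast_sub hfloor1]
    simp
  have hn0 : (0 : ℝ) < n := by exact_mod_cast h3
  have hs1 : 1 ≤ t - n := by linarith [Nat.floor_le (zero_le_one.trans ht)]
  have hs2 : t - n ≤ 2 := by linarith [(Nat.lt_floor_add_one t).le]
  have hflow : flow q H t f = flow q H (t - n) (flow q H n f) := by
    rw [← h.flow_add hf hn0.le (by linarith), add_sub_cancel]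
  rw [hflow]
  refine hRδ _ ⟨hs1, hs2⟩ _ ((h.flow_isPath hf).2 _) _ fun y hy => h1 y ?_
  rw [mem_smul_set]
  refine ⟨(n : ℝ)⁻¹ • y, hball ?_, by rw [smul_smul, mul_inv_cancel₀ hn0.ne', one_smul]⟩
  rw [Metric.mem_ball, dist_eq_norm] at hy ⊢
  have h4 : (n : ℝ)⁻¹ • y - ν =
      (n : ℝ)⁻¹ • ((y - (x + t • ν)) + x + (t - n) • ν) := by
    rw [smul_add, smul_add, smul_sub, smul_smul _ (t - n), mul_sub, inv_mul_cancel₀ hn0.ne',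
      smul_add, smul_smul]
    module
  have h5 : ‖(y - (x + t • ν)) + x + (t - n) • ν‖ < n * ρ := by
    refine (norm_add₃_le).trans_lt (lt_of_le_of_lt ?_ h2)
    rw [norm_smul, Real.norm_eq_abs, abs_of_nonneg (by linarith)]
    gcongr
    exact hB x hx
  rw [h4, norm_smul, norm_inv, Real.norm_eq_abs, abs_of_pos hn0, inv_mul_lt_iff₀ hn0]
  exact h5

end HairTrigger
end

open HairTrigger
theorem proposition5p8 (d : ℕ) (hd : 1 ≤ d)
    (E : Set (Cb d)) (hE : E = Set.univ ∨ E = Buc d)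
    (a : Space d → ℝ) (ha : IsProbabilityKernel a)
    (κ m θ : ℝ) (hκ : 0 < κ) (hm : 0 < m) (G : Cb d → Cb d)
    (hA : Assumptions E a κ m θ G)
    (φ : ℝ → ℝ) (hφ : φ ∈ profiles θ)
    (C : Set (Space d)) (hC : IsCompact C) (hCΥ : C ⊆ interior (Upsilon E a κ m θ G φ 1))
    (ν : Space d) (hν : ν ∈ interior C)
    (hνj : ∀ j : ℕ, 1 ≤ j →
      (1 / (j : ℝ)) • ν ∈ interior (Upsilon E a κ m θ G φ (1 / (j : ℝ))))
    (σ : ℝ) (hσ : 0 < σ) (hσθ : σ < θ) :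
    (∃ r : ℝ, IsWeinbergerRadius E a κ m θ G 1 C σ r) ∧
    ∀ r : ℝ, IsWeinbergerRadius E a κ m θ G 1 C σ r →
      ∀ u₀ : Cb d, u₀ ∈ Buc d → u₀ ∈ tube E θ →
        (∀ x ∈ Metric.ball (0 : Space d) r, σ ≤ u₀ x) →
        ∃ u : ℝ → Cb d, IsSolution E a κ m θ G u₀ u ∧
          (∀ w : ℝ → Cb d, IsSolution E a κ m θ G u₀ w → ∀ t, 0 ≤ t → w t = u t) ∧
          ∀ K : Set (Space d), IsCompact K → K.Nonempty →
            Tendsto (fun t : ℝ => sInf ((fun x => u t (x + t • ν)) '' K)) atTop (𝓝 θ) := by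
  obtain ⟨q, H, h, hH⟩ := hA.exists_isMonotoneReaction hE ha hκ hm
  obtain ⟨Φ, l, hΦ, rfl⟩ := exists_isFrontProfile hφ
  have hP := h.flow_isMonotoneEvolution zero_le_one
  have hCne : C.Nonempty := ⟨ν, interior_subset hν⟩
  constructor
  · have hconst : ∀ r, 0 < r → r < θ →
        Tendsto (fun n => (flow q H 1)^[n] (constFun d r) 0) atTop (𝓝 θ) := by
      intro r h0 h1
      refine (h.tendsto_flow_const (hA.lt_reaction_const ha hH) h0 h1).congr fun n => ?_
      rw [h.flow_iterate (const_mem_tube hE h0.le h1.le)]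
    obtain ⟨r, hr, hspread⟩ := hP.exists_radius_of_subset_interior hΦ hd hconst
      (fun v hv => h.Q_eq_flow hH hv zero_le_one) hC hCΥ hσ hσθ
    refine ⟨r, hr, fun v hv x₀ hx₀ => tendsto_sInf_of_le
      (fun n => (hCne.smul_set).image _) (Eventually.of_forall fun n => ?_) fun ε hε => ?_⟩
    · rintro _ ⟨y, -, rfl⟩
      rw [h.Q_iterate_eq_flow hH hv]
      exact (((h.flow_isPath hv).2 n).2 y).2
    · filter_upwards [hspread v hv x₀ hx₀ ε hε] with n hn
      rintro _ ⟨_, ⟨y, hy, rfl⟩, rfl⟩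
      rw [h.Q_iterate_eq_flow hH hv, ← h.flow_iterate hv]
      exact hn y hy
  · intro r hr u₀ _ hu₀ hσu₀
    refine ⟨fun t => flow q H t u₀, h.isSolution_flow hH hu₀,
      fun w hw t ht => h.isSolution_eq_flow hH hw t ht, fun K hK hKne => ?_⟩
    have hdisc := hr.2 u₀ hu₀ 0 hσu₀
    have hn : ∀ ε > 0, ∀ᶠ n : ℕ in atTop, ∀ y ∈ (n : ℝ) • C, θ - ε ≤ flow q H n u₀ y := by
      intro ε hε
      filter_upwards [hdisc.eventually (lt_mem_nhds (show θ - ε < θ by linarith))] with n hn y hy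
      rw [h.Q_iterate_eq_flow hH hu₀] at hn
      refine hn.le.trans (csInf_le ⟨0, ?_⟩ ⟨y, hy, rfl⟩)
      rintro _ ⟨z, -, rfl⟩
      exact (((h.flow_isPath hu₀).2 n).2 z).1
    refine tendsto_sInf_of_le (fun t => hKne.image _) (Eventually.of_forall fun t => ?_)
      fun ε hε => ?_
    · rintro _ ⟨x, -, rfl⟩
      exact (((h.flow_isPath hu₀).2 t).2 _).2
    · filter_upwards [h.tendsto_flow_along_ray hu₀ hν hn hK hε] with t ht
      rintro _ ⟨x, hx, rfl⟩
      exact ht x hx
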